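/- A *relational schema* is a set of relation names $R$, each with an arity $\mathrm{ar}(R)\ge 1$; a *fact* is an expression $R(c_1,\dots,c_{\mathrm{ar}(R)})$ with constants $c_i$, and a *database* $D$ is a finite set of facts. A (Boolean) $\mathrm{CQ}^{\neg}$ is a query $\exists \bar x\,(\alpha_1\wedge\dots\wedge\alpha_n)$ in which every $\alpha_i$ is an atom $R(\bar t)$, a negated atom $\neg R(\bar t)$, or an inequality $t\neq t'$, with terms that are constants or variables, such that every variable of a negated atom or of an inequality also occurs in a non-negated atom; a $\mathrm{UCQ}^{\neg}$ is a finite disjunction of $\mathrm{CQ}^{\neg}$s. For a $\mathrm{UCQ}^{\neg}$ $q$ let $q^{\pm}$ be the negation-free query obtained by replacing each negated atom $\neg R(\bar t)$ by $R^{-}(\bar t)$ and each non-negated atom $R(\bar t)$ by $R^{+}(\bar t)$, where $R^{+},R^{-}$ are new relation names, and keeping the inequalities. For a database $D$ let $D^{-}$ be the set of facts $R(\bar c)\notin D$ all of whose constants occur in $D$. A set $S\subseteq D$ is a *positive support* of $q$ in $D$ if $\{R^{+}(\bar c) : R(\bar c)\in S\}\cup\{R^{-}(\bar c) : R(\bar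 c)\in D^{-}\}\models q^{\pm}$, and it is *minimal* if no proper subset of it is a positive support of $q$ in $D$. For $B\subseteq D$ let $\xi_q(B)$ be the number of minimal positive supports of $q$ in $D$ that are contained in $B$. The *MPS-Shapley value* of a fact $\alpha\in D$ is the average of $$\xi_q(\{\beta\in D:\beta<\alpha\}\cup\{\alpha\})-\xi_q(\{\beta\in D:\beta<\alpha\})$$ over all linear orderings $<$ of $D$. **Proposition.** For every fixed $\mathrm{UCQ}^{\neg}$ $q$, the MPS-Shapley value is computable in polynomial time in data complexity: for every fixed naming of the relation names and of the constants by pairwise distinct bit strings, the MPS-Shapley value of every fact $\alpha$ of every database $D$ is rational, and there is a (multi-stack) Turing machine that, given $\alpha$ and a list of the facts of $D$ in any order without repetition, outputs this value as a fraction in lowest terms, written in binary, within a number of steps that is polynomial in the length of the input. -/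

import Mathlib

namespace DB

/-- A relational schema: relation names with positive arities. Finiteness is not demanded, so that
the case of a fixed finite schema and the case where each input database comes with its own finite
set of relation names (taken from a common infinite supply) are both covered. -/
structure Schema where
  Rel : Type
  arity : Rel → ℕ
  arity_pos : ∀ R, 0 < arity R

/-- `R(t₁, …, tₖ)` where `k` is the arity of `R` and the `tᵢ` are taken from `T`. -/
@[ext]
structure Atom (σ : Schema) (T : Type*) where
  rel : σ.Rel
  args : Fin (σ.arity rel) → T

/-- A fact is an atom that contains only constants. A database is a finite set of facts. -/
abbrev Fact (σ : Schema) (Const : Type*) := Atom σ Const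

/-- Terms are constants or variables. -/
inductive Term (Const Var : Type*) where
  | const (c : Const)
  | var (x : Var)

/-- Application of a function to all arguments of an atom. -/
def Atom.map {σ : Schema} {T U : Type*} (g : T → U) (a : Atom σ T) : Atom σ U :=
  ⟨a.rel, fun i => g (a.args i)⟩

/-- The value of a term under a valuation of the variables. -/
def Term.eval {Const Var : Type*} (ν : Var → Const) : Term Const Var → Const
  | .const c => c
  | .var x => ν x

/-- The variable `x` occurs in the atom `a`. -/
def Atom.HasVar {σ : Schema} {Const Var : Type*} (a : Atom σ (Term Const Var)) (x : Var) : Prop :=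
  ∃ i, a.args i = Term.var x

/-- A Boolean conjunctive query with safe negated atoms and inequalities: the existential closure
of the conjunction of the atoms in `pos`, the negations of the atoms in `neg`, and the inequalities
`t ≠ t'` for `(t, t')` in `ineq`. -/
structure CQNeg (σ : Schema) (Const Var : Type*) where
  pos : List (Atom σ (Term Const Var))
  neg : List (Atom σ (Term Const Var))
  ineq : List (Term Const Var × Term Const Var)
  safe_neg : ∀ a ∈ neg, ∀ x, a.HasVar x → ∃ b ∈ pos, b.HasVar x
  safe_ineq : ∀ e ∈ ineq, ∀ x, e.1 = .var x ∨ e.2 = .var x → ∃ b ∈ pos, b.HasVar x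

/-- Finite unions (disjunctions) of conjunctive queries with negation. -/
abbrev UCQNeg (σ : Schema) (Const Var : Type*) := List (CQNeg σ Const Var)

/-- `S ⊨ p` for a set of facts `S`. By safety, every variable of `p` is mapped to a constant that
occurs in `S`, so that it does not matter which larger set of constants valuations range over. -/
def CQNeg.Sat {σ : Schema} {Const Var : Type*} (p : CQNeg σ Const Var)
    (S : Set (Fact σ Const)) : Prop :=
  ∃ ν : Var → Const,
    (∀ a ∈ p.pos, a.map (Term.eval ν) ∈ S) ∧
    (∀ a ∈ p.neg, a.map (Term.eval ν) ∉ S) ∧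
    (∀ e ∈ p.ineq, e.1.eval ν ≠ e.2.eval ν)

/-- `S ⊨ q` for a union `q`. -/
def UCQNeg.Sat {σ : Schema} {Const Var : Type*} (q : UCQNeg σ Const Var)
    (S : Set (Fact σ Const)) : Prop :=
  ∃ p ∈ q, CQNeg.Sat p S

/-- The two signs `+` and `−` of signed relation names. -/
inductive Sgn where
  | plus
  | minus

/-- The signed schema, with relation names `R⁺` and `R⁻` of the arity of `R`, for every `R`. -/
def Schema.signed (σ : Schema) : Schema where
  Rel := Sgn × σ.Rel
  arity R := σ.arity R.2
  arity_pos R := σ.arity_pos R.2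

/-- The signed atom `R⁺(t)` or `R⁻(t)` of an atom `R(t)`. -/
def Atom.sign {σ : Schema} {T : Type*} (s : Sgn) (a : Atom σ T) : Atom σ.signed T :=
  ⟨(s, a.rel), a.args⟩

/-- The negation-free query over the signed schema obtained from `p` by replacing each positive
atom `R(t)` by `R⁺(t)` and each negated atom `¬ R(t)` by `R⁻(t)`, and keeping the inequalities. -/
def CQNeg.signed {σ : Schema} {Const Var : Type*} (p : CQNeg σ Const Var) :
    CQNeg σ.signed Const Var where
  pos := p.pos.map (Atom.sign .plus) ++ p.neg.map (Atom.sign .minus)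
  neg := []
  ineq := p.ineq
  safe_neg := by simp
  safe_ineq := by
    intro e he x hx
    obtain ⟨b, hb, hbx⟩ := p.safe_ineq e he x hx
    exact ⟨b.sign .plus, List.mem_append_left _ (List.mem_map_of_mem hb), hbx⟩

/-- The signed version of a union, taken disjunct by disjunct. -/
def UCQNeg.signed {σ : Schema} {Const Var : Type*} (q : UCQNeg σ Const Var) :
    UCQNeg σ.signed Const Var :=
  q.map CQNeg.signed

/-- The active domain of a database. -/
def activeDomain {σ : Schema} {Const : Type*} (D : Finset (Fact σ Const)) : Set Const :=
  {c | ∃ f ∈ D, ∃ i, f.args i = c}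

/-- The facts over the active domain of `D` that are absent from `D`. -/
def negFacts {σ : Schema} {Const : Type*} (D : Finset (Fact σ Const)) : Set (Fact σ Const) :=
  {f | (∀ i, f.args i ∈ activeDomain D) ∧ f ∉ D}

/-- `S ⊆ D` is a positive support of `q` in `D` if the signed version of `q` holds in the set of
all `f⁺` with `f ∈ S` and all `f⁻` with `f` a fact over the active domain of `D` absent
from `D`. -/
def IsPositiveSupport {σ : Schema} {Const Var : Type*} (q : UCQNeg σ Const Var)
    (D S : Finset (Fact σ Const)) : Prop :=
  S ⊆ D ∧ UCQNeg.Sat (UCQNeg.signed q)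
    (Atom.sign .plus '' (S : Set (Fact σ Const)) ∪ Atom.sign .minus '' negFacts D)

/-- Minimality is with respect to set inclusion. -/
def IsMinimalPositiveSupport {σ : Schema} {Const Var : Type*} (q : UCQNeg σ Const Var)
    (D S : Finset (Fact σ Const)) : Prop :=
  Minimal (IsPositiveSupport q D) S

open scoped Classical in
/-- The Shapley value of `α ∈ D` for the wealth function `ξ`: the average, over all linear
orderings of `D`, of `ξ({β ∈ D | β < α} ∪ {α}) - ξ({β ∈ D | β < α})`. A linear ordering of `D` is
given as the bijection `π` that maps each element of `D` to its position. -/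
noncomputable def shapley {F : Type*} (D : Finset F) (ξ : Finset F → ℝ) (α : D) : ℝ :=
  (∑ π : D ≃ Fin D.card,
      (ξ (insert (α : F) ((Finset.univ.filter fun β : D => π β < π α).map
          (Function.Embedding.subtype _)))
        - ξ ((Finset.univ.filter fun β : D => π β < π α).map (Function.Embedding.subtype _))))
    / (Fintype.card (D ≃ Fin D.card) : ℝ)

open scoped Classical in
/-- The wealth function that maps `B ⊆ D` to the number of minimal positive supports of `q` in `D`
that are contained in `B`. -/
noncomputable def mpsWealth {σ : Schema} {Const Var : Type*} (q : UCQNeg σ Const Var)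
    (D B : Finset (Fact σ Const)) : ℝ :=
  ((B.powerset.filter fun S => IsMinimalPositiveSupport q D S).card : ℝ)

/-- The MPS-Shapley value of the fact `α ∈ D`. -/
noncomputable def mpsShapley {σ : Schema} {Const Var : Type*} (q : UCQNeg σ Const Var)
    (D : Finset (Fact σ Const)) (α : D) : ℝ :=
  shapley D (mpsWealth q D) α

/-- An input of the computational problem: a database, given by a list of its facts in an arbitrary
order and without repetition, together with a fact of the database. -/
structure Input (σ : Schema) (Const : Type) where
  facts : List (Fact σ Const)
  nodup : facts.Nodup
  target : Fact σ Const
  target_mem : target ∈ facts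

open scoped Classical in
/-- The database of an input. -/
noncomputable def Input.db {σ : Schema} {Const : Type} (I : Input σ Const) :
    Finset (Fact σ Const) :=
  I.facts.toFinset

/-- The distinguished fact of an input, as an element of its database. -/
noncomputable def Input.fact {σ : Schema} {Const : Type} (I : Input σ Const) : I.db :=
  ⟨I.target, by simpa [Input.db] using I.target_mem⟩

/-- The alphabet used for inputs and outputs: bits and two delimiters. -/
inductive Sym where
  | bit (b : Bool)
  | endWord
  | endFact
  deriving DecidableEq, Fintype

/-- A bit string, followed by a delimiter. -/
def encodeWord (w : List Bool) : List Sym :=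
  w.map Sym.bit ++ [Sym.endWord]

/-- The name of the relation, the names of the constants from left to right, and a delimiter. -/
def encodeFact {σ : Schema} {Const : Type} (relName : σ.Rel ↪ List Bool)
    (constName : Const ↪ List Bool) (f : Fact σ Const) : List Sym :=
  encodeWord (relName f.rel)
    ++ (List.ofFn fun i => encodeWord (constName (f.args i))).flatten ++ [Sym.endFact]

/-- The distinguished fact, followed by all facts of the database. -/
def encodeInput {σ : Schema} {Const : Type} (relName : σ.Rel ↪ List Bool)
    (constName : Const ↪ List Bool) (I : Input σ Const) : List Sym :=
  encodeFact relName constName I.target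
    ++ (I.facts.map (encodeFact relName constName)).flatten

/-- A rational number in lowest terms: one bit for the sign (`true` if it is negative), then the
absolute value of the numerator and the denominator in binary. -/
def encodeRat (r : ℚ) : List Sym :=
  Sym.bit (decide (r < 0)) :: (encodeWord (Computability.encodeNat r.num.natAbs)
    ++ encodeWord (Computability.encodeNat r.den))

end DB

/-!
A minimal positive support contains at most one fact for every positive atom of `q`, so that its
size is at most the total number `K` of positive atoms. In a random linear ordering, `α` completes a
given minimal positive support `S ∋ α` with probability `1 / |S|`, hence the MPS-Shapley value of
`α` is the sum of `1 / |S|` over these `S`. Every `S` of size `m + 1` has `m !` enumerations that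
begin with `α`, and so the value is `1 / K !` times the integer `∑ m < K, K ! / (m + 1) ! * Nₘ`,
where `Nₘ` is the number of `m`-tuples that together with `α` enumerate a minimal positive support.

For a fixed query, these tuples can be counted by letting `m` pointers run through all positions of
the input. Positive supports are closed under supersets within the database, so that it suffices to
test whether a set of at most `K` facts, and each set with one fact less, is a positive support.
This amounts to matching the positive atoms of a disjunct to the facts of the set, which determines
the values of all variables by safety, and to one pass through the input for every negated atom. The
machine has one copy of the input for each pointer, and collects the integer in unary, since it is
polynomially bounded. At the end it divides by `K !`, cancels the fraction and writes it in binary.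
-/

namespace DB

/-! ### Programs over stacks -/

/-- Programs over the stacks `K` with alphabet `Γ`, a structured layer on top of Turing machines
with several stacks. The only control structures are a case distinction on the popped symbol, and a
loop that goes on as long as the popped symbol (`none` if the stack is empty) satisfies a given
condition. -/
inductive Prog (K Γ : Type) where
  | skip
  | push (k : K) (c : Γ)
  | seq (p q : Prog K Γ)
  | popCase (k : K) (p : Option Γ → Prog K Γ)
  | loop (k : K) (go : Option Γ → Bool) (p : Option Γ → Prog K Γ)

namespace Prog

open Function Turing

section Semantics

variable {K Γ : Type} [DecidableEq K]

/-- `Runs p S S' t`: started on the stacks `S`, the program `p` ends with the stacks `S'` after at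
most `t` steps. -/
inductive Runs : Prog K Γ → (K → List Γ) → (K → List Γ) → ℕ → Prop
  | skip (S) : Runs .skip S S 1
  | push (k c S) : Runs (.push k c) S (update S k (c :: S k)) 1
  | seq {p q S S' S'' t t'} : Runs p S S' t → Runs q S' S'' t' → Runs (.seq p q) S S'' (t + t')
  | popCase {k p S S' t} : Runs (p (S k).head?) (update S k (S k).tail) S' t →
      Runs (.popCase k p) S S' (t + 1)
  | loop_exit {k go p S S' t} : go (S k).head? = false →
      Runs (p (S k).head?) (update S k (S k).tail) S' t → Runs (.loop k go p) S S' (t + 1)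
  | loop_next {k go p S S' S'' t t'} : go (S k).head? = true →
      Runs (p (S k).head?) (update S k (S k).tail) S' t →
      Runs (.loop k go p) S' S'' t' → Runs (.loop k go p) S S'' (t + t' + 1)
  | mono {p S S' t t'} : Runs p S S' t → t ≤ t' → Runs p S S' t'

theorem Runs.of_eq {p : Prog K Γ} {S S' S'' : K → List Γ} {t t' : ℕ} (h : Runs p S S' t)
    (hS : S' = S'') (ht : t ≤ t') : Runs p S S'' t' :=
  hS ▸ h.mono ht

theorem Runs.length_le {p : Prog K Γ} {S S' : K → List Γ} {t : ℕ} (h : Runs p S S' t) (k : K) :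
    (S' k).length ≤ (S k).length + t := by
  have pop_le (S : K → List Γ) (j : K) : (update S j (S j).tail k).length ≤ (S k).length := by
    obtain rfl | hk := eq_or_ne k j <;> simp [*]
  induction h with
  | skip S => omega
  | push j c S => obtain rfl | hk := eq_or_ne k j <;> simp [*]
  | seq _ _ ih₁ ih₂ => omega
  | @popCase j _ S _ _ _ ih => have := pop_le S j; omega
  | @loop_exit j _ _ S _ _ _ _ ih => have := pop_le S j; omega
  | @loop_next j _ _ S _ _ _ _ _ _ _ ih₁ ih₂ => have := pop_le S j; omega
  | mono _ _ ih => omega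

theorem Runs.push_eq {k : K} {c : Γ} {S S' : K → List Γ} (h : update S k (c :: S k) = S') :
    Runs (.push k c) S S' 1 :=
  h ▸ Runs.push k c S

end Semantics

section Compilation

variable {K Γ : Type}

/-- The labels of the machine code of a program. -/
def Label : Prog K Γ → Type
  | .skip => Unit
  | .push _ _ => Unit
  | .seq p q => Label p ⊕ Label q
  | .popCase _ p => Option (Σ o, Label (p o))
  | .loop _ _ p => Option (Σ o, Label (p o))

/-- Programs over a finite alphabet have finitely many labels. -/
@[reducible]
def labelFintype [Fintype Γ] : ∀ p : Prog K Γ, Fintype (Label p)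
  | .skip => inferInstanceAs (Fintype Unit)
  | .push _ _ => inferInstanceAs (Fintype Unit)
  | .seq p q =>
    letI := labelFintype p
    letI := labelFintype q
    inferInstanceAs (Fintype (Label p ⊕ Label q))
  | .popCase _ p =>
    letI := fun o => labelFintype (p o)
    inferInstanceAs (Fintype (Option (Σ o, Label (p o))))
  | .loop _ _ p =>
    letI := fun o => labelFintype (p o)
    inferInstanceAs (Fintype (Option (Σ o, Label (p o))))

/-- The label at which a program starts. -/
def entry : ∀ p : Prog K Γ, Label p
  | .skip => ()
  | .push _ _ => ()
  | .seq p _ => Sum.inl (entry p)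
  | .popCase _ _ => (none : Option _)
  | .loop _ _ _ => (none : Option _)

/-- The machine code of a program, with labels embedded by `e`, that continues at `x`. The internal
state of the machine is the symbol popped last. -/
def code : ∀ (p : Prog K Γ) {Λ : Type} (_ : Label p → Λ) (_ : Λ),
    Label p → TM2.Stmt (fun _ : K => Γ) Λ (Option Γ)
  | .skip, _, _, x, _ => .goto fun _ => x
  | .push k c, _, _, x, _ => .push k (fun _ => c) (.goto fun _ => x)
  | .seq p q, _, e, _, Sum.inl l => code p (fun l => e (Sum.inl l)) (e (Sum.inr (entry q))) l
  | .seq _ q, _, e, x, Sum.inr l => code q (fun l => e (Sum.inr l)) x l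
  | .popCase k p, _, e, _, (none : Option _) =>
    .pop k (fun _ o => o) (.goto fun v => e (some ⟨v, entry (p v)⟩))
  | .popCase _ p, _, e, x, some ⟨o, l⟩ => code (p o) (fun l => e (some ⟨o, l⟩)) x l
  | .loop k _ p, _, e, _, (none : Option _) =>
    .pop k (fun _ o => o) (.goto fun v => e (some ⟨v, entry (p v)⟩))
  | .loop _ go p, _, e, x, some ⟨o, l⟩ =>
    code (p o) (fun l => e (some ⟨o, l⟩)) (if go o then e (none : Option _) else x) l

variable [DecidableEq K]

/-- The machine with the statements `M` gets from `c` to `c'` in at most `t` steps. -/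
def Reaches {Λ V : Type} (M : Λ → TM2.Stmt (fun _ : K => Γ) Λ V)
    (c c' : TM2.Cfg (fun _ : K => Γ) Λ V) (t : ℕ) : Prop :=
  Nonempty (StateTransition.EvalsToInTime (TM2.step M) c (some c') t)

section Reaches

variable {Λ V : Type} {M : Λ → TM2.Stmt (fun _ : K => Γ) Λ V}
  {c c' c'' : TM2.Cfg (fun _ : K => Γ) Λ V} {t t' : ℕ}

theorem Reaches.of_step (h : TM2.step M c = some c') : Reaches M c c' 1 :=
  ⟨⟨⟨1, by simpa [flip] using h⟩, le_rfl⟩⟩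

theorem Reaches.trans (h : Reaches M c c' t) (h' : Reaches M c' c'' t') :
    Reaches M c c'' (t + t') := by
  obtain ⟨⟨h⟩, ⟨h'⟩⟩ := And.intro h h'
  exact ⟨by rw [add_comm]; exact h.trans _ _ _ _ _ _ h'⟩

theorem Reaches.mono (h : Reaches M c c' t) (ht : t ≤ t') : Reaches M c c' t' :=
  h.map fun h => ⟨h.toEvalsTo, h.steps_le_m.trans ht⟩

theorem Reaches.of_stmt {l : Λ} {s : TM2.Stmt (fun _ : K => Γ) Λ V} (h : M l = s) (v : V)
    (S : K → List Γ) : Reaches M ⟨some l, v, S⟩ (TM2.stepAux s v S) 1 :=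
  .of_step (congrArg (fun s => some (TM2.stepAux s v S)) h)

end Reaches

theorem Runs.reaches {p : Prog K Γ} {S S' : K → List Γ} {t : ℕ} (h : Runs p S S' t) {Λ : Type}
    (e : Label p → Λ) (x : Λ) (M : Λ → TM2.Stmt (fun _ : K => Γ) Λ (Option Γ))
    (hM : ∀ l, M (e l) = code p e x l) (v : Option Γ) :
    ∃ v', Reaches M ⟨some (e (entry p)), v, S⟩ ⟨some x, v', S'⟩ t := by
  induction h generalizing x v with
  | skip S => exact ⟨v, .of_stmt (hM _) v S⟩
  | push k c S => exact ⟨v, .of_stmt (hM _) v S⟩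
  | @seq p q S S' S'' t t' _ _ ih₁ ih₂ =>
    obtain ⟨v₁, h₁⟩ := ih₁ (fun l => e (Sum.inl l)) (e (Sum.inr (entry q)))
      (fun l => hM (Sum.inl l)) v
    obtain ⟨v₂, h₂⟩ := ih₂ (fun l => e (Sum.inr l)) x (fun l => hM (Sum.inr l)) v₁
    exact ⟨v₂, h₁.trans h₂⟩
  | @popCase k p S S' t _ ih =>
    obtain ⟨v₁, h₁⟩ := ih (fun l => e (some ⟨(S k).head?, l⟩)) x (fun l => hM (some ⟨_, l⟩)) _
    exact ⟨v₁, ((Reaches.of_stmt (hM (none : Option _)) v S).trans h₁).mono (add_comm _ _).le⟩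
  | @loop_exit k go p S S' t hk _ ih =>
    obtain ⟨v₁, h₁⟩ := ih (fun l => e (some ⟨(S k).head?, l⟩)) x
      (fun l => (hM (some ⟨_, l⟩)).trans (by simp only [code, hk]; rfl)) _
    exact ⟨v₁, ((Reaches.of_stmt (hM (none : Option _)) v S).trans h₁).mono (add_comm _ _).le⟩
  | @loop_next k go p S S' S'' t t' hk _ _ ih₁ ih₂ =>
    obtain ⟨v₁, h₁⟩ := ih₁ (fun l => e (some ⟨(S k).head?, l⟩)) (e (none : Option _))
      (fun l => (hM (some ⟨_, l⟩)).trans (by simp only [code, hk]; rfl)) (S k).head?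
    obtain ⟨v₂, h₂⟩ := ih₂ e x hM v₁
    exact ⟨v₂, (((Reaches.of_stmt (hM (none : Option _)) v S).trans h₁).trans h₂).mono (by omega)⟩
  | mono _ ht ih =>
    obtain ⟨v₁, h₁⟩ := ih e x hM v
    exact ⟨v₁, h₁.mono ht⟩

/-- The machine that runs `p`, with input stack `i` and output stack `o`. -/
def machine [Fintype K] [Fintype Γ] (p : Prog K Γ) (i o : K) : FinTM2 where
  K := K
  k₀ := i
  k₁ := o
  Γ _ := Γ
  Λ := Option (Label p)
  main := some (entry p)
  ΛFin := letI := labelFintype p; inferInstance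
  σ := Option Γ
  initialState := none
  Γk₀Fin := inferInstanceAs (Fintype Γ)
  m l := l.elim (.load (fun _ => none) .halt) (code p some none)

theorem initList_machine [Fintype K] [Fintype Γ] (p : Prog K Γ) (i o : K) (l : List Γ) :
    initList (machine p i o) l = ⟨some (some (entry p)), none, update (fun _ => []) i l⟩ := by
  refine congrArg (TM2.Cfg.mk _ none) (funext fun k : K => ?_)
  by_cases hk : k = i
  · subst hk
    exact (dif_pos rfl).trans (update_self (β := fun _ => List Γ) _ l _).symm
  · exact (dif_neg hk).trans (update_of_ne (β := fun _ => List Γ) (f := fun _ => []) hk l).symm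

theorem haltList_machine [Fintype K] [Fintype Γ] (p : Prog K Γ) (i o : K) (l : List Γ) :
    haltList (machine p i o) l = ⟨none, none, update (fun _ => []) o l⟩ := by
  refine congrArg (TM2.Cfg.mk none none) (funext fun k : K => ?_)
  by_cases hk : k = o
  · subst hk
    exact (dif_pos rfl).trans (update_self (β := fun _ => List Γ) _ l _).symm
  · exact (dif_neg hk).trans (update_of_ne (β := fun _ => List Γ) (f := fun _ => []) hk l).symm

theorem Runs.machine_outputs [Fintype K] [Fintype Γ] {p : Prog K Γ} {i o : K} {l l' : List Γ}
    {t : ℕ} (h : Runs p (update (fun _ => []) i l) (update (fun _ => []) o l') t) :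
    Nonempty (TM2OutputsInTime (machine p i o) l (some l') (t + 1)) := by
  obtain ⟨v, hv⟩ := h.reaches (Λ := Option (Label p)) some none (machine p i o).m
    (fun _ => rfl) none
  have halts : Reaches (Λ := Option (Label p)) (machine p i o).m
      ⟨some none, v, update (fun _ => []) o l'⟩ ⟨none, none, update (fun _ => []) o l'⟩ 1 :=
    .of_step rfl
  have outputs : Nonempty (StateTransition.EvalsToInTime (machine p i o).step
      (initList (machine p i o) l) (some (haltList (machine p i o) l')) (t + 1)) := by
    rw [initList_machine, haltList_machine]
    exact hv.trans halts
  exact outputs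

theorem computableInPolyTime_of_runs [Finite K] [Finite Γ] (p : Prog K Γ) (i o : K)
    {α β : Type} (ea : α → List Γ) (eb : β → List Γ) (f : α → β) (t : Polynomial ℕ)
    (h : ∀ a, Runs p (update (fun _ => []) i (ea a)) (update (fun _ => []) o (eb (f a)))
      (t.eval (ea a).length)) :
    Nonempty (TM2ComputableInPolyTime ea eb f) := by
  have := Fintype.ofFinite K
  have := Fintype.ofFinite Γ
  have outputs (a : α) : Nonempty (TM2OutputsInTime (machine p i o) (ea a) (some (eb (f a)))
      ((t + 1).eval (ea a).length)) := by
    rw [Polynomial.eval_add, Polynomial.eval_one]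
    exact (h a).machine_outputs
  have map_refl (l : List Γ) : l.map (Equiv.refl Γ).invFun = l := l.map_id
  refine ⟨{ tm := machine p i o
            inputAlphabet := Equiv.refl Γ
            outputAlphabet := Equiv.refl Γ
            time := t + 1
            outputsFun := fun a => ?_ }⟩
  exact cast (congrArg₂ (fun l l' => TM2OutputsInTime (machine p i o) l (some l') _)
    (map_refl _).symm (map_refl _).symm) (outputs a).some

end Compilation

end Prog

namespace Prog

open Function

section StackPrograms

variable {K Γ : Type} [DecidableEq K]

/-- Run the programs of a list one after the other. -/
def seqs : List (Prog K Γ) → Prog K Γ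
  | [] => .skip
  | p :: ps => .seq p (seqs ps)

/-- Pop the stack `k` until it is empty, and run `p c` for every popped symbol `c`. -/
def drain (k : K) (p : Γ → Prog K Γ) : Prog K Γ :=
  .loop k Option.isSome fun o => o.elim .skip p

theorem runs_drain_nil {k : K} {p : Γ → Prog K Γ} {S : K → List Γ} (h : S k = []) :
    Runs (drain k p) S S 2 := by
  refine Runs.loop_exit (t := 1) (by simp [h]) ?_
  have tail_eq : update S k (S k).tail = S := by rw [h, List.tail_nil, ← h, update_eq_self]
  rw [tail_eq, h]
  exact Runs.skip S

theorem runs_drain_cons {k : K} {p : Γ → Prog K Γ} {S S₁ S' S'' : K → List Γ} {c : Γ}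
    {l : List Γ} {t t' : ℕ} (h : S k = c :: l) (hS₁ : update S k l = S₁) (h₁ : Runs (p c) S₁ S' t)
    (h₂ : Runs (drain k p) S' S'' t') : Runs (drain k p) S S'' (t + t' + 1) := by
  subst hS₁
  refine Runs.loop_next (by simp [h]) ?_ h₂
  rw [h]
  exact h₁

/-- Push the symbol `c` on every stack in `ks`. -/
def pushEach (ks : List K) (c : Γ) : Prog K Γ :=
  seqs (ks.map fun k => .push k c)

theorem runs_pushEach (c : Γ) : ∀ (ks : List K) (S : K → List Γ), ks.Nodup →
    Runs (pushEach ks c) S (fun j => if j ∈ ks then c :: S j else S j) (ks.length + 1)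
  | [], S, _ => (Runs.skip S).of_eq (by simp) (by simp)
  | k :: ks, S, h => by
    rw [List.nodup_cons] at h
    refine ((Runs.push k c S).seq (runs_pushEach c ks _ h.2)).of_eq (funext fun j => ?_) ?_
    · obtain rfl | hj := eq_or_ne j k
      · simp [h.1]
      · simp [hj]
    · simp only [List.length_cons]
      omega

/-- Move the symbols of the stack `k`, up to and including the first one that violates `go`, to
each of the stacks in `ks`. This reverses their order. -/
def transfer (go : Γ → Bool) (k : K) (ks : List K) : Prog K Γ :=
  .loop k (Option.any go) fun o => o.elim .skip (pushEach ks)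

theorem runs_transfer (go : Γ → Bool) {k : K} {ks : List K} (hks : ks.Nodup) (hk : k ∉ ks) :
    ∀ (l : List Γ) (S : K → List Γ), S k = l →
      Runs (transfer go k ks) S
        (fun j => if j ∈ ks then (l.takeWhile go ++ (l.dropWhile go).take 1).reverse ++ S j
          else if j = k then (l.dropWhile go).tail else S j)
        ((ks.length + 2) * (l.length + 1))
  | [], S, h => by
    refine (Runs.loop_exit (t := 1) (by simp [h]) (by rw [h]; exact Runs.skip _)).of_eq
      (funext fun j => ?_) (by simp)
    obtain rfl | hj := eq_or_ne j k <;> simp [*]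
  | c :: l, S, h => by
    have pushed := runs_pushEach c ks (update S k l) hks
    cases hc : go c with
    | false =>
      refine (Runs.loop_exit (t := ks.length + 1) (by simp [h, hc]) (by rw [h]; exact pushed)).of_eq
        (funext fun j => ?_) (by simp only [List.length_cons]; lia)
      obtain rfl | hj := eq_or_ne j k <;> simp [*]
    | true =>
      refine (Runs.loop_next (by simp [h, hc]) (by rw [h]; exact pushed)
        (runs_transfer go hks hk l _ (by simp [hk]))).of_eq (funext fun j => ?_)
        (by simp only [List.length_cons]; linarith)
      obtain rfl | hj := eq_or_ne j k
      · simp [hk, hc]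
      · by_cases hm : j ∈ ks <;> simp [*]

/-- Move the contents of the stack `k` to the stack `k'`, which reverses their order. -/
def move (k k' : K) : Prog K Γ :=
  transfer (fun _ => true) k [k']

theorem runs_move {k k' : K} (hk : k ≠ k') (S : K → List Γ) :
    Runs (move k k') S (update (update S k []) k' ((S k).reverse ++ S k'))
      (3 * ((S k).length + 1)) := by
  refine (runs_transfer _ (List.nodup_singleton k') (by simpa using hk) _ S rfl).of_eq
    (funext fun j => ?_) le_rfl
  obtain rfl | hj := eq_or_ne j k' <;>
    simp [update_apply, List.takeWhile_eq_self_iff.2, List.dropWhile_eq_nil_iff.2, *]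

/-- Empty the stack `k`. -/
def clear (k : K) : Prog K Γ :=
  transfer (fun _ => true) k []

theorem runs_clear (k : K) (S : K → List Γ) :
    Runs (clear k) S (update S k []) (2 * ((S k).length + 1)) :=
  (runs_transfer _ List.nodup_nil List.not_mem_nil _ S rfl).of_eq
    (funext fun j => by simp [update_apply, List.dropWhile_eq_nil_iff.2]) le_rfl

theorem runs_clearEach {n : ℕ} : ∀ (ks : List K) (S : K → List Γ),
    (∀ k ∈ ks, (S k).length ≤ n) →
      Runs (seqs (ks.map clear)) S (fun j => if j ∈ ks then [] else S j)
        (ks.length * (2 * (n + 1)) + 1)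
  | [], S, _ => .of_eq (.skip S) (by simp) (by simp)
  | k :: ks, S, h => by
    have shorter (j : K) (hj : j ∈ ks) : (update S k [] j).length ≤ n := by
      obtain rfl | hjk := eq_or_ne j k
      · simp
      · simpa [hjk] using h j (by simp [hj])
    refine .of_eq (.seq (runs_clear k S) (runs_clearEach ks _ shorter)) (funext fun j => ?_) ?_
    · obtain rfl | hj := eq_or_ne j k <;> simp [*]
    · have := h k (by simp)
      rw [List.length_cons]
      linarith

/-- Pop up to `f` symbols from the stack `k`, and run the program `p (j + i)` when `i` symbols have
been popped. -/
def popCount (k : K) (p : ℕ → Prog K Γ) : ℕ → ℕ → Prog K Γ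
  | 0, j => p j
  | f + 1, j => .popCase k fun o => o.elim (p j) fun _ => popCount k p f (j + 1)

theorem runs_popCount {k : K} {p : ℕ → Prog K Γ} {S' : K → List Γ} {t : ℕ} :
    ∀ (f j : ℕ) (S : K → List Γ),
      Runs (p (j + min f (S k).length)) (update S k ((S k).drop f)) S' t →
        Runs (popCount k p f j) S S' (t + f)
  | 0, j, S, h => by simpa [popCount] using h
  | f + 1, j, S, h => by
    refine (Runs.popCase (t := t + f) ?_).mono le_rfl
    cases hS : S k with
    | nil => exact Runs.mono (by simpa [hS] using h) (Nat.le_add_right t f)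
    | cons c l =>
      refine runs_popCount f (j + 1) _ ?_
      simpa [hS, add_assoc, add_comm 1, Nat.succ_min_succ] using h

/-- Push the symbols of `w` from left to right on the stack `k`. -/
def pushes (k : K) (w : List Γ) : Prog K Γ :=
  seqs (w.map (.push k))

theorem runs_pushes {k : K} : ∀ (w : List Γ) (S : K → List Γ),
    Runs (pushes k w) S (update S k (w.reverse ++ S k)) (w.length + 1)
  | [], S => (Runs.skip S).of_eq (by simp) (by simp)
  | c :: w, S => (Runs.seq (Runs.push k c S) (runs_pushes w _)).of_eq (by simp)
      (by simp only [List.length_cons]; omega)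

end StackPrograms

end Prog

/-- The symbol is a bit, as opposed to a delimiter. -/
def Sym.isBit : Sym → Bool
  | .bit _ => true
  | _ => false

/-- The first piece of a string: everything up to and including the first delimiter. -/
def piece (l : List Sym) : List Sym :=
  l.takeWhile Sym.isBit ++ (l.dropWhile Sym.isBit).take 1

/-- What follows after the first piece of a string. -/
def afterPiece (l : List Sym) : List Sym :=
  (l.dropWhile Sym.isBit).tail

/-- The piece with number `a` of a string, counted from `0`. -/
def pieceAt (a : ℕ) (l : List Sym) : List Sym :=
  piece (afterPiece^[a] l)

theorem piece_append_afterPiece (l : List Sym) : piece l ++ afterPiece l = l := by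
  rw [piece, afterPiece, List.append_assoc, ← List.drop_one, List.take_append_drop,
    List.takeWhile_append_dropWhile]

theorem length_afterPiece_le (l : List Sym) : (afterPiece l).length ≤ l.length := by
  conv_rhs => rw [← piece_append_afterPiece l]
  simp

theorem length_iterate_afterPiece_le (a : ℕ) (l : List Sym) :
    (afterPiece^[a] l).length ≤ l.length := by
  induction a generalizing l with
  | zero => rfl
  | succ a ih => exact (ih _).trans (length_afterPiece_le l)

theorem length_pieceAt_le (a : ℕ) (l : List Sym) : (pieceAt a l).length ≤ l.length := by
  refine le_trans ?_ (length_iterate_afterPiece_le a l)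
  conv_rhs => rw [← piece_append_afterPiece (afterPiece^[a] l)]
  simp [pieceAt]

namespace Prog

open Function

section Fetch

variable {K : Type} [DecidableEq K] {r x k : K}

/-- Move the first `a` pieces on the stack `r` to the stack `x`. -/
def skipPieces (r x : K) (a : ℕ) : Prog K Sym :=
  seqs (List.replicate a (transfer Sym.isBit r [x]))

theorem runs_skipPieces (hrx : r ≠ x) : ∀ (a : ℕ) (S : K → List Sym),
    ∃ w, w ++ afterPiece^[a] (S r) = S r ∧
      Runs (skipPieces r x a) S (update (update S r (afterPiece^[a] (S r))) x (w.reverse ++ S x))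
        (a * (3 * ((S r).length + 1)) + 1)
  | 0, S => ⟨[], rfl, (Runs.skip S).of_eq (by simp) (by simp)⟩
  | a + 1, S => by
    have first : Runs (transfer Sym.isBit r [x]) S
        (update (update S r (afterPiece (S r))) x ((piece (S r)).reverse ++ S x))
        (3 * ((S r).length + 1)) :=
      (runs_transfer _ (List.nodup_singleton x) (by simpa using hrx) _ S rfl).of_eq
        (funext fun j => by
          obtain rfl | hj := eq_or_ne j x <;> simp [update_apply, piece, afterPiece, *]) le_rfl
    obtain ⟨w, hw, rest⟩ := runs_skipPieces hrx a
      (update (update S r (afterPiece (S r))) x ((piece (S r)).reverse ++ S x))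
    simp only [update_of_ne hrx, update_self] at hw rest
    refine ⟨piece (S r) ++ w, ?_, (first.seq rest).of_eq (funext fun j => ?_) ?_⟩
    · rw [iterate_succ_apply, List.append_assoc, hw, piece_append_afterPiece]
    · obtain rfl | hj := eq_or_ne j x <;> obtain rfl | hr := eq_or_ne j r <;> simp [*]
    · have := length_afterPiece_le (S r)
      have : a * (3 * ((afterPiece (S r)).length + 1)) ≤ a * (3 * ((S r).length + 1)) := by gcongr
      linarith

/-- Push the piece with number `a` on the stack `r` on the stack `k`, without changing `r`; the
stack `x` is needed as temporary storage. -/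
def fetch (r x k : K) (a : ℕ) : Prog K Sym :=
  .seq (skipPieces r x a) (.seq (transfer Sym.isBit r [x, k]) (move x r))

theorem runs_fetch (hrx : r ≠ x) (hrk : r ≠ k) (hxk : x ≠ k) (a : ℕ) (S : K → List Sym)
    (hx : S x = []) :
    Runs (fetch r x k a) S (update S k ((pieceAt a (S r)).reverse ++ S k))
      ((3 * a + 8) * ((S r).length + 1)) := by
  obtain ⟨w, hw, skipped⟩ := runs_skipPieces hrx a S
  set S₁ := update (update S r (afterPiece^[a] (S r))) x (w.reverse ++ S x)
  have copied := runs_transfer Sym.isBit (k := r) (ks := [x, k]) (by simpa using hxk)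
    (by simp [hrx, hrk]) _ S₁ rfl
  rw [← piece, ← afterPiece] at copied
  have hS₁ : S₁ r = afterPiece^[a] (S r) := by simp [S₁, hrx]
  have hS : w ++ (piece (S₁ r) ++ afterPiece (S₁ r)) = S r := by
    rw [piece_append_afterPiece, hS₁, hw]
  refine (skipped.seq (copied.seq (runs_move hrx.symm _))).of_eq (funext fun j => ?_) ?_
  · obtain rfl | hj := eq_or_ne j r
    · rw [update_of_ne hrk, ← hS]
      simp [S₁, hrx, hrk, hx]
    · obtain rfl | hjx := eq_or_ne j x
      · simp [hj, hxk, hx]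
      · obtain rfl | hjk := eq_or_ne j k <;> simp [S₁, pieceAt, *]
  · have hlen := congrArg List.length hS
    simp only [List.length_append] at hlen
    have : (S₁ r).length ≤ (S r).length := hS₁ ▸ length_iterate_afterPiece_le a (S r)
    have hS₁x : S₁ x = w.reverse := by simp [S₁, hx]
    simp only [List.length_cons, List.length_nil, List.mem_cons, true_or, if_true, hS₁x,
      List.length_append, List.length_reverse]
    linarith

end Fetch

end Prog

/-! ### Pointers into the input -/

/-- The names of the stacks of the machine. For every pointer `i`, a copy of the input is split at
the pointer between the stacks `left i` and `right i`. There are three auxiliary stacks, a stack of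
truth values, a unary counter, and the output. -/
inductive Stk (ι : Type) where
  | left (i : ι)
  | right (i : ι)
  | aux
  | fst
  | snd
  | truth
  | count
  | out
  deriving DecidableEq, Fintype

/-- The contents of all stacks. -/
structure Stacks (ι : Type) where
  left : ι → List Sym
  right : ι → List Sym
  aux : List Sym
  fst : List Sym
  snd : List Sym
  truth : List Sym
  count : List Sym
  out : List Sym

namespace Stacks

open Function

variable {ι : Type}

/-- The contents of the stack with a given name. -/
@[simp]
def get (S : Stacks ι) : Stk ι → List Sym
  | .left i => S.left i
  | .right i => S.right i
  | .aux => S.aux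
  | .fst => S.fst
  | .snd => S.snd
  | .truth => S.truth
  | .count => S.count
  | .out => S.out

variable [DecidableEq ι] (S : Stacks ι) (w : List Sym)

@[simp]
theorem update_get_left (i : ι) :
    update S.get (.left i) w = { S with left := update S.left i w }.get :=
  funext fun k => by cases k <;> simp [update_apply]

@[simp]
theorem update_get_right (i : ι) :
    update S.get (.right i) w = { S with right := update S.right i w }.get :=
  funext fun k => by cases k <;> simp [update_apply]

@[simp]
theorem update_get_aux : update S.get .aux w = { S with aux := w }.get :=
  funext fun k => by cases k <;> simp

@[simp]
theorem update_get_fst : update S.get .fst w = { S with fst := w }.get :=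
  funext fun k => by cases k <;> simp

@[simp]
theorem update_get_snd : update S.get .snd w = { S with snd := w }.get :=
  funext fun k => by cases k <;> simp

@[simp]
theorem update_get_truth : update S.get .truth w = { S with truth := w }.get :=
  funext fun k => by cases k <;> simp

@[simp]
theorem update_get_count : update S.get .count w = { S with count := w }.get :=
  funext fun k => by cases k <;> simp

@[simp]
theorem update_get_out : update S.get .out w = { S with out := w }.get :=
  funext fun k => by cases k <;> simp

end Stacks

namespace Prog

open Function

variable {ι : Type} [DecidableEq ι]

/-- The relation `Runs` for the stacks `Stk ι`. -/
abbrev Exec (p : Prog (Stk ι) Sym) (S S' : Stacks ι) (t : ℕ) : Prop :=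
  Runs p S.get S'.get t

section Comparison

/-- Replace the topmost truth value by `false`. -/
def setFalse : Prog (Stk ι) Sym :=
  .popCase .truth fun _ => .push .truth (.bit false)

theorem exec_setFalse (S : Stacks ι) {c : Sym} {b : List Sym} (hb : S.truth = c :: b) :
    Exec setFalse S { S with truth := .bit false :: b } 2 :=
  .popCase (.push_eq (by simp [hb]))

/-- Remove from `snd` as many symbols as there are in `fst`, emptying `fst`, and set the topmost
truth value to `false` unless they agree. -/
def matchPrefix : Prog (Stk ι) Sym :=
  drain .fst fun c => .popCase .snd fun o => if o = some c then .skip else setFalse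

theorem exec_matchPrefix (b : List Sym) : ∀ (u v : List Sym) (e : Bool) (S : Stacks ι),
    Exec matchPrefix { S with fst := u, snd := v, truth := .bit e :: b }
      { S with fst := [], snd := v.drop u.length, truth := .bit (e && u.isPrefixOf v) :: b }
      (4 * u.length + 2)
  | [], v, e, S => .of_eq (runs_drain_nil rfl) (by simp) le_rfl
  | c :: u, v, e, S => by
    have first : Exec (.popCase .snd fun o => if o = some c then .skip else setFalse)
        { S with fst := u, snd := v, truth := .bit e :: b }
        { S with fst := u, snd := v.tail, truth := .bit (e && v.head? == some c) :: b } 3 := by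
      refine .popCase ?_
      by_cases h : v.head? = some c
      · simpa [h] using (Runs.skip _).mono one_le_two
      · simpa [h, beq_eq_false_iff_ne.2 h] using
          exec_setFalse { S with fst := u, snd := v.tail, truth := .bit e :: b } rfl
    refine .of_eq (runs_drain_cons rfl (Stacks.update_get_fst _ _) first
      (exec_matchPrefix b u v.tail _ S)) ?_ (by simp only [List.length_cons]; omega)
    cases v with
    | nil => simp
    | cons d v => simp [List.isPrefixOf, Bool.and_assoc, BEq.comm (a := c)]

theorem exec_drain_setFalse (b : List Sym) : ∀ (v : List Sym) (e : Bool) (S : Stacks ι),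
    Exec (drain .snd fun _ => setFalse) { S with snd := v, truth := .bit e :: b }
      { S with snd := [], truth := .bit (e && v.isEmpty) :: b } (3 * v.length + 2)
  | [], e, S => .of_eq (runs_drain_nil rfl) (by simp) le_rfl
  | c :: v, e, S =>
    .of_eq (runs_drain_cons rfl (Stacks.update_get_snd _ _) (exec_setFalse _ rfl)
      (exec_drain_setFalse b v false S)) (by simp) (by simp only [List.length_cons]; omega)

/-- Compare and empty the stacks `fst` and `snd`, and push the truth value of their equality. -/
def compareWords : Prog (Stk ι) Sym :=
  .seq (.push .truth (.bit true)) (.seq matchPrefix (drain .snd fun _ => setFalse))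

theorem exec_compareWords (S : Stacks ι) :
    Exec compareWords S
      { S with fst := [], snd := [], truth := .bit (decide (S.fst = S.snd)) :: S.truth }
      (4 * S.fst.length + 3 * S.snd.length + 5) := by
  have equal_iff (u v : List Sym) :
      (u.isPrefixOf v && (v.drop u.length).isEmpty) = decide (u = v) := by
    induction u generalizing v with
    | nil => cases v <;> simp
    | cons c u ih => cases v <;> simp [← ih, List.isPrefixOf, Bool.and_assoc, beq_eq_decide]
  refine .of_eq (.seq (.push_eq (Stacks.update_get_truth _ _))
    (.seq (exec_matchPrefix S.truth S.fst S.snd true S)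
      (exec_drain_setFalse S.truth _ _ { S with fst := [] }))) ?_ ?_
  · simp [equal_iff]
  · simp only [List.length_drop]
    omega

end Comparison

end Prog

namespace Prog

open Function Stk

variable {ι : Type}

/-- A string that is given explicitly, or as the piece with number `a` after the pointer `i`. -/
inductive Ref (ι : Type) where
  | word (w : List Sym)
  | piece (i : ι) (a : ℕ)

namespace Ref

/-- The string that is referred to. -/
def val (s : List Sym) (x : ι → ℕ) : Ref ι → List Sym
  | .word w => w
  | .piece i a => pieceAt a (s.drop (x i))

theorem exists_length_val_le (e : Ref ι) : ∃ n, ∀ s x, (e.val s x).length ≤ s.length + n := by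
  cases e with
  | word w => exact ⟨w.length, fun s _ => by simp [val]⟩
  | piece i a => exact ⟨0, fun _ _ => (length_pieceAt_le a _).trans (by simp)⟩

end Ref

variable [DecidableEq ι]

/-- The stacks when the pointers are at the positions `x` of the input `s`, with truth values `b`
and unary counter `q`. -/
def config (s : List Sym) (x : ι → ℕ) (b q : List Sym) : Stacks ι where
  left i := (s.take (x i)).reverse
  right i := s.drop (x i)
  aux := []
  fst := []
  snd := []
  truth := b
  count := q
  out := []

open scoped Classical in
/-- Some program finds out in polynomial time whether `P s x` holds, for all inputs `s` and all
positions `x` of the pointers that satisfy `C`. -/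
def PolyDecidable (C : (ι → ℕ) → Prop) (P : List Sym → (ι → ℕ) → Prop) : Prop :=
  ∃ (p : Prog (Stk ι) Sym) (t : Polynomial ℕ), ∀ s x b q, C x →
    Exec p (config s x b q) (config s x (.bit (decide (P s x)) :: b) q) (t.eval s.length)

/-- Some program adds the number `N s x` to the unary counter in polynomial time, for all inputs
`s` and all positions `x` of the pointers that satisfy `C`. -/
def PolyComputable (C : (ι → ℕ) → Prop) (N : List Sym → (ι → ℕ) → ℕ) : Prop :=
  ∃ (p : Prog (Stk ι) Sym) (t : Polynomial ℕ), ∀ s x b q, C x →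
    Exec p (config s x b q) (config s x b (List.replicate (N s x) (.bit true) ++ q))
      (t.eval s.length)

variable {C C' : (ι → ℕ) → Prop} {P P' : List Sym → (ι → ℕ) → Prop}
  {N N' : List Sym → (ι → ℕ) → ℕ}

section Decision

theorem PolyDecidable.congr (h : PolyDecidable C P) (hP : ∀ s x, C x → (P s x ↔ P' s x)) :
    PolyDecidable C P' := by
  obtain ⟨p, t, h⟩ := h
  refine ⟨p, t, fun s x b q hx => ?_⟩
  rw [← decide_eq_decide.2 (hP s x hx)]
  exact h s x b q hx

theorem PolyDecidable.not (h : PolyDecidable C P) : PolyDecidable C fun s x => ¬ P s x := by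
  obtain ⟨p, t, h⟩ := h
  refine ⟨.seq p (.popCase truth fun o => .push truth (.bit (o = some (.bit false)))), t + 2,
    fun s x b q hx => .of_eq (.seq (h s x b q hx) (.popCase (.push_eq ?_))) rfl ?_⟩
  · by_cases hP : P s x <;> simp [config, hP]
  · simp

/-- Replace the two topmost truth values by their disjunction. -/
def disjoin : Prog (Stk ι) Sym :=
  .popCase truth fun o => .popCase truth fun o' =>
    .push truth (.bit (o' = some (.bit true) ∨ o = some (.bit true)))

theorem exec_disjoin (S : Stacks ι) {c c' : Bool} {b : List Sym}
    (h : S.truth = .bit c' :: .bit c :: b) :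
    Exec disjoin S { S with truth := .bit (c || c') :: b } 3 :=
  .popCase (.popCase (.push_eq (by simp [h])))

theorem PolyDecidable.or (h : PolyDecidable C P) (h' : PolyDecidable C P') :
    PolyDecidable C fun s x => P s x ∨ P' s x := by
  obtain ⟨p, t, h⟩ := h
  obtain ⟨p', t', h'⟩ := h'
  refine ⟨.seq p (.seq p' disjoin), t + (t' + 3), fun s x b q hx => .of_eq
    (.seq (h s x b q hx) (.seq (h' s x _ q hx) (exec_disjoin _ rfl))) ?_ (by simp)⟩
  by_cases hP : P s x <;> by_cases hP' : P' s x <;> simp [config, hP, hP']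

theorem PolyDecidable.and (h : PolyDecidable C P) (h' : PolyDecidable C P') :
    PolyDecidable C fun s x => P s x ∧ P' s x :=
  (h.not.or h'.not).not.congr fun s x _ => by tauto

theorem PolyDecidable.const (a : Prop) : PolyDecidable C fun _ _ => a := by
  classical
  exact ⟨.push truth (.bit (decide a)), 1, fun s x b q _ =>
    .of_eq (.push_eq (by simp [config])) rfl (by simp)⟩

theorem PolyDecidable.exists_mem {η : Type*} (L : List η) {P : η → List Sym → (ι → ℕ) → Prop}
    (h : ∀ a ∈ L, PolyDecidable C (P a)) : PolyDecidable C fun s x => ∃ a ∈ L, P a s x := by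
  induction L with
  | nil => exact (const False).congr fun s x _ => by simp
  | cons a L ih =>
    exact ((h a (by simp)).or (ih fun b hb => h b (by simp [hb]))).congr fun s x _ => by simp

theorem PolyDecidable.exists {η : Type*} [Finite η] {P : η → List Sym → (ι → ℕ) → Prop}
    (h : ∀ a, PolyDecidable C (P a)) : PolyDecidable C fun s x => ∃ a, P a s x := by
  cases nonempty_fintype η
  exact (exists_mem Finset.univ.toList fun a _ => h a).congr fun s x _ => by simp

theorem PolyDecidable.forall_mem {η : Type*} (L : List η) {P : η → List Sym → (ι → ℕ) → Prop}
    (h : ∀ a ∈ L, PolyDecidable C (P a)) : PolyDecidable C fun s x => ∀ a ∈ L, P a s x :=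
  (exists_mem L fun a ha => (h a ha).not).not.congr fun s x _ => by simp

theorem PolyDecidable.forall {η : Type*} [Finite η] {P : η → List Sym → (ι → ℕ) → Prop}
    (h : ∀ a, PolyDecidable C (P a)) : PolyDecidable C fun s x => ∀ a, P a s x :=
  (PolyDecidable.exists fun a => (h a).not).not.congr fun s x _ => by simp

theorem polyDecidable_getLast?_take (i : ι) (f : Option Sym → Bool) :
    PolyDecidable C fun s x => f (s.take (x i)).getLast? = true := by
  have test_top (S : Stacks ι) : Exec (.popCase (left i) fun o =>
      .seq (o.elim .skip (.push (left i))) (.push truth (.bit (f o))))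
      S { S with truth := .bit (f (S.left i).head?) :: S.truth } 3 := by
    refine .popCase (t := 2) (.seq (S' := S.get) ?_ (.push_eq (by simp)))
    cases h : S.left i with
    | nil =>
      have unchanged : update S.left i [] = S.left := by rw [← h, update_eq_self]
      simpa [h, unchanged] using Runs.skip S.get
    | cons c w =>
      have unchanged : update S.left i (c :: w) = S.left := by rw [← h, update_eq_self]
      simpa [h] using Runs.push_eq (by simp [unchanged])
  refine ⟨_, 3, fun s x b q _ => .of_eq (test_top _) ?_ (by simp)⟩
  simp [config]

namespace Ref

/-- Push a string that is referred to on the stack `k`. -/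
def load (k : Stk ι) : Ref ι → Prog (Stk ι) Sym
  | .word w => pushes k w
  | .piece i a => fetch (right i) aux k a

theorem exists_runs_load (e : Ref ι) {k : Stk ι} (hk : k ≠ aux) (hright : ∀ i, k ≠ right i) :
    ∃ t : Polynomial ℕ, ∀ (s : List Sym) (x : ι → ℕ) (S : Stacks ι),
      S.aux = [] → (∀ i, S.right i = s.drop (x i)) →
      Runs (e.load k) S.get (update S.get k ((e.val s x).reverse ++ S.get k))
        (t.eval s.length) := by
  cases e with
  | word w => exact ⟨(w.length : Polynomial ℕ) + 1, fun s x S _ _ =>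
      (runs_pushes w _).mono (by simp)⟩
  | piece i a =>
    refine ⟨((3 * a + 8 : ℕ) : Polynomial ℕ) * (Polynomial.X + 1), fun s x S haux hS =>
      .of_eq (runs_fetch (by simp) (hright i).symm hk.symm a S.get haux) (by simp [val, hS]) ?_⟩
    simp only [Stacks.get, hS, List.length_drop, Polynomial.eval_mul, Polynomial.eval_natCast,
      Nat.cast_id, Polynomial.eval_add, Polynomial.eval_X, Polynomial.eval_one]
    gcongr
    omega

end Ref

theorem polyDecidable_eq (e e' : Ref ι) : PolyDecidable C fun s x => e.val s x = e'.val s x := by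
  obtain ⟨t, loaded⟩ := e.exists_runs_load (k := fst) (by simp) (by simp)
  obtain ⟨t', loaded'⟩ := e'.exists_runs_load (k := snd) (by simp) (by simp)
  obtain ⟨n, hn⟩ := e.exists_length_val_le
  obtain ⟨n', hn'⟩ := e'.exists_length_val_le
  refine ⟨.seq (e.load fst) (.seq (e'.load snd) compareWords),
    t + (t' + (4 * (Polynomial.X + (n : Polynomial ℕ)) +
      3 * (Polynomial.X + (n' : Polynomial ℕ)) + 5)), fun s x b q _ => ?_⟩
  have first : Exec (e.load fst) (config s x b q)
      { config s x b q with fst := (e.val s x).reverse } (t.eval s.length) :=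
    .of_eq (loaded s x _ rfl fun _ => rfl) (by simp [config]) le_rfl
  have second : Exec (e'.load snd) { config s x b q with fst := (e.val s x).reverse }
      { config s x b q with fst := (e.val s x).reverse, snd := (e'.val s x).reverse }
      (t'.eval s.length) :=
    .of_eq (loaded' s x _ rfl fun _ => rfl) (by simp [config]) le_rfl
  refine .of_eq (first.seq (second.seq (exec_compareWords _))) ?_ ?_
  · simp only [config, List.reverse_inj]
    congr!
  · have := hn s x
    have := hn' s x
    simp only [List.length_reverse, Polynomial.eval_add, Polynomial.eval_mul,
      Polynomial.eval_ofNat, Polynomial.eval_X, Polynomial.eval_natCast, Nat.cast_id]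
    omega

end Decision

end Prog

namespace Prog

open Function Stk

variable {ι : Type} [DecidableEq ι] {C C' : (ι → ℕ) → Prop} {P : List Sym → (ι → ℕ) → Prop}
  {N N' : List Sym → (ι → ℕ) → ℕ}

section Loops

/-- Run `p` and move the pointer `i` forward, until the end of the input is reached. -/
def advance (i : ι) (p : Prog (Stk ι) Sym) : Prog (Stk ι) Sym :=
  drain (right i) fun c => .seq (.push (right i) c) (.seq p
    (.popCase (right i) fun _ => .push (left i) c))

/-- Run `p` for all positions of the pointer `i`. -/
def forPositions (i : ι) (p : Prog (Stk ι) Sym) : Prog (Stk ι) Sym :=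
  .seq (advance i p) (move (left i) (right i))

variable {i : ι} {p : Prog (Stk ι) Sym} {s : List Sym} {x : ι → ℕ} {b q : ℕ → List Sym} {t : ℕ}

theorem exec_advance
    (h : ∀ k < s.length, Exec p (config s (update x i k) (b k) (q k))
      (config s (update x i k) (b (k + 1)) (q (k + 1))) t) (d k : ℕ) (hk : k + d = s.length) :
    Exec (advance i p) (config s (update x i k) (b k) (q k))
      (config s (update x i s.length) (b s.length) (q s.length)) (d * (t + 4) + 2) := by
  induction d generalizing k with
  | zero =>
    obtain rfl : k = s.length := by omega
    exact (runs_drain_nil (by simp [config])).mono (by omega)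
  | succ d ih =>
    have hk' : k < s.length := by omega
    have popped : update (config s (update x i k) (b k) (q k)).get (right i) (s.drop (k + 1)) =
        { config s (update x i k) (b k) (q k) with
          right := update (fun j => s.drop (update x i k j)) i (s.drop (k + 1)) }.get := by
      simp [config]
    refine (runs_drain_cons (c := s[k]) (by simp [config]) popped
      (.seq (.push_eq (S' := (config s (update x i k) (b k) (q k)).get) ?_)
        (.seq (h k hk') (.popCase (.push_eq ?_)))) (ih (k + 1) (by omega))).mono (by linarith)
    · simp only [config, Stacks.update_get_right, Stacks.get, update_self, update_idem,
        List.getElem_cons_drop]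
      congr 2
      funext j
      obtain rfl | hj := eq_or_ne j i <;> simp [*]
    · simp only [config, Stacks.update_get_right, Stacks.update_get_left, Stacks.get, update_self,
        List.tail_drop]
      congr 2 <;> funext j <;> obtain rfl | hj := eq_or_ne j i
      · rw [update_self, update_self, List.take_succ_eq_append_getElem hk', List.reverse_append]
        rfl
      all_goals simp [*]

theorem exec_forPositions (hx : x i = 0)
    (h : ∀ k < s.length, Exec p (config s (update x i k) (b k) (q k))
      (config s (update x i k) (b (k + 1)) (q (k + 1))) t) :
    Exec (forPositions i p) (config s x (b 0) (q 0)) (config s x (b s.length) (q s.length))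
      (s.length * (t + 7) + 5) := by
  have advanced := exec_advance h s.length 0 (by omega)
  rw [← hx, update_eq_self, hx] at advanced
  refine .of_eq (advanced.seq (runs_move (by simp) _)) ?_ ?_
  · simp only [config, Stacks.update_get_right, Stacks.update_get_left, Stacks.get]
    congr 2 <;> funext j <;> obtain rfl | hj := eq_or_ne j i <;> simp [*]
  · simp only [config, Stacks.get, update_self, List.length_reverse, List.length_take, min_self]
    linarith

theorem PolyDecidable.exists_position (h : PolyDecidable C P) (hi : ∀ x, C' x → x i = 0)
    (hC : ∀ x k, C' x → C (update x i k)) :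
    PolyDecidable C' fun s x => ∃ k < s.length, P s (update x i k) := by
  classical
  obtain ⟨p, t, h⟩ := h
  have accumulate (s : List Sym) (x : ι → ℕ) (b q : List Sym) (k : ℕ) (hx : C' x) :
      Exec (.seq p disjoin)
        (config s (update x i k) (.bit (decide (∃ n < k, P s (update x i n))) :: b) q)
        (config s (update x i k) (.bit (decide (∃ n < k + 1, P s (update x i n))) :: b) q)
        (t.eval s.length + 3) := by
    refine .of_eq (.seq (h s _ _ q (hC x k hx)) (exec_disjoin _ rfl)) ?_ le_rfl
    simp [config, Nat.exists_lt_succ_right, -Order.lt_add_one_iff]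
  refine ⟨.seq (.push truth (.bit false)) (forPositions i (.seq p disjoin)),
    1 + (Polynomial.X * (t + 10) + 5), fun s x b q hx => ?_⟩
  refine .of_eq (.seq (.push_eq ?_) (exec_forPositions (hi x hx)
    (b := fun n => .bit (decide (∃ k < n, P s (update x i k))) :: b) (q := fun _ => q)
    fun k _ => accumulate s x b q k hx)) (by congr!) ?_
  · simp [config]
  · simp [add_assoc]

theorem PolyComputable.congr (h : PolyComputable C N) (hN : ∀ s x, C x → N s x = N' s x) :
    PolyComputable C N' := by
  obtain ⟨p, t, h⟩ := h
  exact ⟨p, t, fun s x b q hx => hN s x hx ▸ h s x b q hx⟩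

theorem PolyComputable.const (n : ℕ) : PolyComputable C fun _ _ => n :=
  ⟨pushes count (List.replicate n (.bit true)), (n : Polynomial ℕ) + 1, fun s x b q _ =>
    .of_eq (runs_pushes _ _) (by simp [config]) (by simp)⟩

theorem PolyComputable.add (h : PolyComputable C N) (h' : PolyComputable C N') :
    PolyComputable C fun s x => N s x + N' s x := by
  obtain ⟨p, t, h⟩ := h
  obtain ⟨p', t', h'⟩ := h'
  refine ⟨.seq p p', t + t', fun s x b q hx =>
    .of_eq (.seq (h s x b q hx) (h' s x b _ hx)) ?_ (by simp)⟩
  rw [← List.append_assoc, ← List.replicate_add, add_comm]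

theorem PolyComputable.sum {η : Type*} (F : Finset η) {N : η → List Sym → (ι → ℕ) → ℕ}
    (h : ∀ a ∈ F, PolyComputable C (N a)) : PolyComputable C fun s x => ∑ a ∈ F, N a s x := by
  classical
  induction F using Finset.induction_on with
  | empty => simpa using const 0
  | @insert a F ha ih =>
    exact ((h a (by simp)).add (ih fun b hb => h b (by simp [hb]))).congr
      fun s x _ => (Finset.sum_insert (f := fun a => N a s x) ha).symm

open scoped Classical in
theorem PolyComputable.ite (h : PolyDecidable C P) (h' : PolyComputable C N) :
    PolyComputable C fun s x => if P s x then N s x else 0 := by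
  obtain ⟨p, t, h⟩ := h
  obtain ⟨p', t', h'⟩ := h'
  refine ⟨.seq p (.popCase truth fun o => if o = some (.bit true) then p' else .skip), t + (t' + 2),
    fun s x b q hx => .of_eq (.seq (h s x b q hx) (.popCase (t := t'.eval s.length + 1) ?_))
      rfl (by simp [add_assoc])⟩
  by_cases hP : P s x
  · simpa [config, hP] using (h' s x b q hx).mono (Nat.le_succ _)
  · simpa [config, hP] using (Runs.skip _).mono (Nat.le_add_left _ _)

theorem PolyComputable.sum_positions (h : PolyComputable C N) (hi : ∀ x, C' x → x i = 0)
    (hC : ∀ x k, C' x → C (update x i k)) :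
    PolyComputable C' fun s x => ∑ k ∈ Finset.range s.length, N s (update x i k) := by
  obtain ⟨p, t, h⟩ := h
  refine ⟨forPositions i p, Polynomial.X * (t + 7) + 5, fun s x b q hx => ?_⟩
  have accumulate (k : ℕ) :
      Exec p (config s (update x i k) b
          (List.replicate (∑ n ∈ Finset.range k, N s (update x i n)) (.bit true) ++ q))
        (config s (update x i k) b
          (List.replicate (∑ n ∈ Finset.range (k + 1), N s (update x i n)) (.bit true) ++ q))
        (t.eval s.length) := by
    refine .of_eq (h s _ b _ (hC x k hx)) ?_ le_rfl
    rw [← List.append_assoc, ← List.replicate_add, Finset.sum_range_succ, add_comm]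
  exact .of_eq (exec_forPositions (hi x hx) (b := fun _ => b) (q := fun n =>
    List.replicate (∑ k ∈ Finset.range n, N s (update x i k)) (.bit true) ++ q)
    fun k _ => accumulate k) rfl (by simp)

end Loops

end Prog

/-! ### Output of a fraction in lowest terms -/

section BinaryNumbers

theorem encodeNat_eq_bits (n : ℕ) : Computability.encodeNat n = n.bits := by
  have pos (p : PosNum) : Computability.encodePosNum p = (p : ℕ).bits := by
    induction p with
    | one => simp [Computability.encodePosNum]
    | bit0 p ih =>
      rw [Computability.encodePosNum, ih, PosNum.cast_bit0, ← two_mul,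
        Nat.bit0_bits _ (PosNum.cast_pos p).ne']
    | bit1 p ih =>
      rw [Computability.encodePosNum, ih, PosNum.cast_bit1, ← two_mul, Nat.bit1_bits]
  have num (m : Num) : Computability.encodeNum m = (m : ℕ).bits := by
    cases m with
    | zero => simp [Computability.encodeNum]
    | pos p => simpa [Computability.encodeNum] using pos p
  rw [Computability.encodeNat, num, Num.to_of_nat]

theorem bits_eq_cons {n : ℕ} (hn : n ≠ 0) : n.bits = decide (n % 2 = 1) :: (n / 2).bits := by
  obtain ⟨k, rfl⟩ | ⟨k, rfl⟩ := n.even_or_odd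
  · have hk : k ≠ 0 := by omega
    rw [← two_mul, Nat.bit0_bits k hk, Nat.mul_mod_right, Nat.mul_div_cancel_left k two_pos]
    rfl
  · have half : (2 * k + 1) / 2 = k := by omega
    rw [Nat.bit1_bits, Nat.mul_add_mod, half]
    rfl

theorem length_bits_le (n : ℕ) : n.bits.length ≤ n := by
  rw [Nat.size_eq_bits_len, Nat.size_le]
  exact Nat.lt_two_pow_self

theorem encodeRat_div (n : ℕ) {m : ℕ} (hm : 0 < m) : encodeRat ((n : ℚ) / m) =
    .bit false :: (encodeWord (n / n.gcd m).bits ++ encodeWord (m / n.gcd m).bits) := by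
  have nonneg : ¬ (n : ℚ) / m < 0 := not_lt.2 (by positivity)
  have eq_mkRat : (n : ℚ) / m = mkRat n m := by rw [Rat.mkRat_eq_div, Int.cast_natCast]
  have num_eq : ((n : ℚ) / m).num.natAbs = n / n.gcd m := by
    rw [eq_mkRat, Rat.num_mkRat, if_neg hm.ne', Int.natAbs_natCast, Nat.gcd_comm]
    norm_cast
  have den_eq : ((n : ℚ) / m).den = m / n.gcd m := by
    rw [eq_mkRat, Rat.den_mkRat, if_neg hm.ne', Int.natAbs_natCast, Nat.gcd_comm]
  rw [encodeRat, num_eq, den_eq, encodeNat_eq_bits, encodeNat_eq_bits, decide_eq_false nonneg]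

theorem div_gcd_mul_div_add_mod_div_gcd (n m : ℕ) :
    m / n.gcd m * (n / m) + n % m / n.gcd m = n / n.gcd m := by
  have dvd_mod : n.gcd m ∣ n % m :=
    (Nat.dvd_mod_iff (Nat.gcd_dvd_right n m)).2 (Nat.gcd_dvd_left n m)
  conv_rhs => enter [1]; rw [← Nat.div_add_mod n m]
  rw [Nat.add_div_of_dvd_left dvd_mod, Nat.mul_div_right_comm (Nat.gcd_dvd_right n m)]

theorem monotone_eval (t : Polynomial ℕ) : Monotone fun n => t.eval n := by
  intro m n h
  beta_reduce
  rw [Polynomial.eval_eq_sum_range, Polynomial.eval_eq_sum_range]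
  gcongr

end BinaryNumbers

namespace Prog

open Function Stk

variable {ι : Type} [DecidableEq ι]

section Output

/-- A number in unary. -/
abbrev unary (n : ℕ) : List Sym :=
  List.replicate n (.bit true)

/-- Add the quotient of the number in `count` by `m` to the number in `aux`, and push the remainder
on `snd`. -/
def divMod (m : ℕ) : Prog (Stk ι) Sym :=
  drain count fun _ => popCount count
    (fun j => if j = m then .push aux (.bit true) else pushes snd (unary j)) (m - 1) 1

theorem exec_divMod {m : ℕ} (hm : 0 < m) (S : Stacks ι) (hS : S.snd = []) (n c : ℕ) :
    Exec (divMod m) { S with count := unary n, aux := unary c }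
      { S with count := [], aux := unary (c + n / m), snd := unary (n % m) }
      (n * (2 * m) + 2) := by
  induction n using Nat.strong_induction_on generalizing c with
  | _ n ih =>
    obtain _ | n := n
    · exact .of_eq (runs_drain_nil rfl) (by simp [← hS]) (by simp)
    · by_cases hmn : m ≤ n + 1
      · have rest := ih (n + 1 - m) (by omega) (c + 1)
        refine .of_eq (runs_drain_cons (t := 1 + (m - 1)) rfl (Stacks.update_get_count _ _)
          (runs_popCount _ _ _ ?_) rest) ?_ ?_
        · have popped : 1 + min (m - 1) n = m := by omega
          have left_over : n - (m - 1) = n + 1 - m := by omega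
          simpa [popped, left_over] using Runs.push_eq (by simp [List.replicate_succ])
        · rw [Nat.div_eq_sub_div hm hmn, Nat.mod_eq_sub_mod hmn, add_right_comm, add_assoc c]
        · have := Nat.mul_le_mul_right (2 * m) (show n + 1 - m ≤ n by omega)
          have : m - 1 + 1 = m := by omega
          linarith
      · rw [not_le] at hmn
        refine .of_eq (runs_drain_cons (t := n + 2 + (m - 1)) rfl (Stacks.update_get_count _ _)
          (S' := { S with count := [], aux := unary c, snd := unary (n + 1) }.get)
          (runs_popCount _ _ _ ?_) (runs_drain_nil rfl)) ?_ ?_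
        · have popped : 1 + min (m - 1) n = n + 1 := by omega
          have exhausted : n - (m - 1) = 0 := by omega
          have pushed : Exec (pushes snd (unary (n + 1)))
              { S with count := [], aux := unary c }
              { S with count := [], aux := unary c, snd := unary (n + 1) } (n + 2) :=
            .of_eq (runs_pushes _ _) (by simp [hS]) (by simp)
          simpa [popped, exhausted, hmn.ne] using pushed
        · rw [Nat.div_eq_of_lt hmn, Nat.mod_eq_of_lt hmn, add_zero]
        · have := Nat.le_mul_of_pos_right (n + 1) hm
          have : m - 1 + 1 = m := by omega
          have := Nat.le_mul_of_pos_left m n.succ_pos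
          linarith

/-- Add `m` times the number in `aux` to the number in `count`. -/
def multiply (m : ℕ) : Prog (Stk ι) Sym :=
  drain aux fun _ => pushes count (unary m)

theorem exec_multiply (m : ℕ) (S : Stacks ι) : ∀ c n,
    Exec (multiply m) { S with aux := unary c, count := unary n }
      { S with aux := [], count := unary (m * c + n) } (c * (m + 2) + 2)
  | 0, n => .of_eq (runs_drain_nil rfl) (by simp) (by simp)
  | c + 1, n => by
    have first : Exec (pushes count (unary m)) { S with aux := unary c, count := unary n }
        { S with aux := unary c, count := unary (m + n) } (m + 1) :=
      .of_eq (runs_pushes _ _) (by simp) (by simp)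
    refine .of_eq (runs_drain_cons rfl (Stacks.update_get_aux _ _) first
      (exec_multiply m S c (m + n))) ?_ (by linarith)
    rw [mul_add, mul_one, add_assoc]

/-- Replace the number `n` in `count` by `n / 2`, and push the lowest bit of `n` on `fst`. -/
def halve : Prog (Stk ι) Sym :=
  .seq (divMod 2) (.seq (popCount snd (fun j => .push fst (.bit (j = 1))) 1 0) (move aux count))

theorem exec_halve (S : Stacks ι) (haux : S.aux = []) (hsnd : S.snd = []) (n : ℕ) :
    Exec halve { S with count := unary n }
      { S with count := unary (n / 2), fst := .bit (decide (n % 2 = 1)) :: S.fst }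
      (6 * n + 7) := by
  have divided : Exec (divMod 2) { S with count := unary n }
      { S with count := [], aux := unary (n / 2), snd := unary (n % 2) } (n * (2 * 2) + 2) := by
    simpa [← haux] using exec_divMod two_pos S hsnd n 0
  refine .of_eq (.seq divided (.seq (runs_popCount _ _ _ (.push_eq rfl))
    (runs_move (by simp) _))) ?_ ?_
  · have : min 1 (n % 2) = n % 2 := by omega
    have exhausted : n % 2 - 1 = 0 := by omega
    simp [this, exhausted, hsnd, haux]
  · simp only [Stacks.get, List.drop_replicate, Stacks.update_get_snd, List.length_replicate, ne_eq,
      reduceCtorEq, not_false_eq_true, update_of_ne]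
    omega

/-- Replace the unary number in `count` by its binary representation, in `fst`. -/
def binary : Prog (Stk ι) Sym :=
  drain count fun _ => .seq (.push count (.bit true)) halve

theorem exec_binary (S : Stacks ι) (haux : S.aux = []) (hsnd : S.snd = []) (n : ℕ) :
    ∀ u, Exec binary { S with count := unary n, fst := u }
      { S with count := [], fst := (n.bits.map Sym.bit).reverse ++ u } (n * (6 * n + 9) + 2) := by
  induction n using Nat.strong_induction_on with
  | _ n ih =>
    intro u
    obtain _ | n := n
    · exact .of_eq (runs_drain_nil rfl) (by simp) (by simp)
    · have first : Exec (.seq (.push count (.bit true)) halve)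
          { S with count := unary n, fst := u }
          { S with
            count := unary ((n + 1) / 2), fst := .bit (decide ((n + 1) % 2 = 1)) :: u }
          (1 + (6 * (n + 1) + 7)) :=
        .seq (.push_eq (by simp [List.replicate_succ]))
          (exec_halve { S with fst := u } haux hsnd (n + 1))
      refine .of_eq (runs_drain_cons rfl (Stacks.update_get_count _ _) first
        (ih ((n + 1) / 2) (by omega) _)) (by simp [bits_eq_cons n.succ_ne_zero]) ?_
      have : (n + 1) / 2 ≤ n := by omega
      have : (n + 1) / 2 * (6 * ((n + 1) / 2) + 9) ≤ n * (6 * (n + 1) + 9) := by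
        gcongr
        omega
      linarith

/-- Write the fraction `(m * c + k) / m` in lowest terms, where `aux` holds `c` in unary. -/
def writeFraction (m k : ℕ) : Prog (Stk ι) Sym :=
  .seq (multiply (m / k.gcd m)) <| .seq (pushes count (unary (k / k.gcd m))) <|
  .seq (pushes out (encodeWord (m / k.gcd m).bits).reverse) <|
  .seq (.push out .endWord) <| .seq binary <| .seq (move fst out) (.push out (.bit false))

theorem exec_writeFraction (s : List Sym) (x : ι → ℕ) (b : List Sym) {m : ℕ} (hm : 0 < m)
    (n : ℕ) :
    Exec (writeFraction m (n % m)) { config s x b [] with aux := unary (n / m) }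
      { config s x b [] with out := encodeRat ((n : ℚ) / m) }
      (n * (m + 2) + n * (6 * n + 9) + 3 * n + 2 * m + 12) := by
  have mod_gcd : (n % m).gcd m = n.gcd m := by rw [← Nat.gcd_rec, Nat.gcd_comm]
  have num_eq := div_gcd_mul_div_add_mod_div_gcd n m
  rw [writeFraction, mod_gcd, encodeRat_div n hm, ← num_eq]
  have den_le : m / n.gcd m ≤ m := Nat.div_le_self _ _
  have mod_le : n % m / n.gcd m ≤ m := (Nat.div_le_self _ _).trans (Nat.mod_lt n hm).le
  have num_le := num_eq.trans_le (Nat.div_le_self n (n.gcd m))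
  have div_le : n / m ≤ n := Nat.div_le_self _ _
  generalize m / n.gcd m = d at *
  generalize n % m / n.gcd m = e at *
  generalize n / m = c at *
  have multiplied := exec_multiply d (config s x b []) c 0
  have converted := exec_binary
    { config s x b [] with out := .endWord :: encodeWord d.bits } rfl rfl (d * c + e) []
  refine .of_eq (.seq multiplied <| .seq (runs_pushes _ _) <| .seq (runs_pushes _ _) <|
    .seq (.push_eq ?_) <| .seq converted <| .seq (runs_move (by simp) _) <| .push_eq rfl) ?_ ?_
  · simp [config, add_comm e]
  · simp [config, encodeWord]
  · have := length_bits_le d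
    have := length_bits_le (d * c + e)
    have : (d * c + e) * (6 * (d * c + e) + 9) ≤ n * (6 * n + 9) := by gcongr
    have : c * (d + 2) ≤ n * (m + 2) := by gcongr
    simp only [List.length_replicate, encodeWord, List.length_reverse, List.length_append,
      List.length_map, List.length_cons, List.length_nil, Stacks.get, List.append_nil]
    linarith

/-- Write the number in `count`, divided by `m`, in lowest terms. -/
def writeQuotient (m : ℕ) : Prog (Stk ι) Sym :=
  .seq (divMod m) (popCount snd (writeFraction m) m 0)

theorem exec_writeQuotient (s : List Sym) (x : ι → ℕ) (b : List Sym) {m : ℕ} (hm : 0 < m)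
    (n : ℕ) :
    Exec (writeQuotient m) (config s x b (unary n))
      { config s x b [] with out := encodeRat ((n : ℚ) / m) }
      (n * (2 * m) + 2 + (n * (m + 2) + n * (6 * n + 9) + 3 * n + 2 * m + 12 + m)) := by
  have divided := exec_divMod hm (config s x b []) rfl n 0
  have remainder_le : n % m ≤ m := (Nat.mod_lt n hm).le
  refine .seq divided (runs_popCount _ _ _ ?_)
  simpa [config, remainder_le] using exec_writeFraction s x b hm n

end Output

end Prog

namespace Prog

open Function Stk Turing

section Input

variable {ι : Type} [DecidableEq ι] [Fintype ι]

/-- Distribute the input, given on the stack `right i₀`, to all stacks `right i`. -/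
noncomputable def distribute (i₀ : ι) : Prog (Stk ι) Sym :=
  .seq (move (right i₀) aux) (transfer (fun _ => true) aux (Finset.univ.toList.map right))

theorem runs_distribute (i₀ : ι) (s : List Sym) :
    Runs (distribute i₀) (update (fun _ => []) (right i₀) s) (config s 0 [] []).get
      ((Fintype.card ι + 5) * (s.length + 1)) := by
  have copied := runs_transfer (fun _ => true) (k := aux)
    (ks := (Finset.univ : Finset ι).toList.map right)
    ((Finset.nodup_toList _).map fun _ _ => Stk.right.inj) (by simp) _
    (update (fun _ => []) aux s.reverse) rfl
  refine .of_eq (.seq (.of_eq (runs_move (by simp) _) (by simp) le_rfl) copied)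
    (funext fun k => ?_) ?_
  · cases k <;>
      simp [config, Stacks.get, List.takeWhile_eq_self_iff.2, List.dropWhile_eq_nil_iff.2]
  · simp only [update_self, List.length_reverse, List.length_map, Finset.length_toList,
      Finset.card_univ]
    linarith

/-- Remove the copies of the input. -/
noncomputable def clearInputs : Prog (Stk ι) Sym :=
  seqs ((Finset.univ.toList.map right).map clear)

theorem runs_clearInputs (s w : List Sym) :
    Runs clearInputs { config s (0 : ι → ℕ) [] [] with out := w }.get (update (fun _ => []) out w)
      (Fintype.card ι * (2 * (s.length + 1)) + 1) := by
  refine .of_eq (runs_clearEach (n := s.length) _ _ (by simp [config, Stacks.get]))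
    (funext fun k => ?_) (by simp)
  cases k <;> simp [config, Stacks.get]

end Input

theorem PolyComputable.computable_div {ι : Type} [DecidableEq ι] [Finite ι]
    {C : (ι → ℕ) → Prop} {N : List Sym → (ι → ℕ) → ℕ} (h : PolyComputable C N) (hC : C 0)
    (i₀ : ι) {m : ℕ} (hm : 0 < m) {α : Type} (ea : α → List Sym) :
    Nonempty (TM2ComputableInPolyTime ea encodeRat fun a => (N (ea a) 0 : ℚ) / m) := by
  have := Fintype.ofFinite ι
  obtain ⟨p, t, hp⟩ := h
  let c : Polynomial ℕ := Fintype.card ι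
  let quotientTime : Polynomial ℕ := .X * (2 * m) + 2 +
    (.X * (m + 2) + .X * (6 * .X + 9) + 3 * .X + 2 * m + 12 + m)
  refine computableInPolyTime_of_runs
    (.seq (distribute i₀) (.seq p (.seq (writeQuotient m) clearInputs))) (right i₀) out ea encodeRat
    _ ((c + 5) * (.X + 1) + (t + (quotientTime.comp t + (c * (2 * (.X + 1)) + 1)))) fun a => ?_
  have counted := hp (ea a) 0 [] [] hC
  rw [List.append_nil] at counted
  have N_le : N (ea a) 0 ≤ t.eval (ea a).length := by
    simpa [config] using counted.length_le count
  have written := (exec_writeQuotient (ea a) (0 : ι → ℕ) [] hm (N (ea a) 0)).mono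
    (t' := quotientTime.eval (t.eval (ea a).length)) <| by
      refine le_trans (le_of_eq ?_) (monotone_eval quotientTime N_le)
      simp [quotientTime]
  refine ((runs_distribute i₀ _).seq (counted.seq (written.seq (runs_clearInputs _ _)))).mono ?_
  simp [c]

end Prog

/-! ### Shapley values and critical tuples -/

section Shapley

open Finset

variable {F : Type*}

theorem card_equiv_forall_le_mul_card {κ : Type*} [Fintype F] [DecidableEq F] [Fintype κ]
    [LinearOrder κ] (S : Finset F) {a : F} (ha : a ∈ S) :
    #{π : F ≃ κ | ∀ b ∈ S, π b ≤ π a} * #S = Fintype.card (F ≃ κ) := by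
  have symmetric : ∀ c ∈ S, #{π : F ≃ κ | ∀ b ∈ S, π b ≤ π c} =
      #{π : F ≃ κ | ∀ b ∈ S, π b ≤ π a} := fun c hc => by
    have swap_mem (b : F) : Equiv.swap a c b ∈ S ↔ b ∈ S := by
      rw [Equiv.swap_apply_def]
      split_ifs <;> simp_all
    refine card_equiv (Equiv.equivCongr (Equiv.swap a c) (.refl κ)) fun π => ?_
    rw [mem_filter_univ, mem_filter_univ, ← (Equiv.swap a c).forall_congr_right]
    simp [swap_mem]
  have cover : (S.biUnion fun c => {π : F ≃ κ | ∀ b ∈ S, π b ≤ π c}) = univ := by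
    ext π
    simpa using exists_max_image S π ⟨a, ha⟩
  have disjoint : (S : Set F).PairwiseDisjoint
      fun c => ({π : F ≃ κ | ∀ b ∈ S, π b ≤ π c} : Finset (F ≃ κ)) := by
    intro c hc d hd hcd
    refine disjoint_left.2 fun π hπc hπd => hcd (π.injective ?_)
    rw [mem_filter_univ] at hπc hπd
    exact le_antisymm (hπd c hc) (hπc d hd)
  have total := congrArg card cover
  rw [card_biUnion disjoint, sum_congr rfl symmetric, sum_const, smul_eq_mul, card_univ] at total
  rw [mul_comm, total]

open scoped Classical in
theorem card_subsets_insert_sub_card_subsets (P : Finset F → Prop) {a : F} {B : Finset F}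
    (ha : a ∉ B) :
    (#{S ∈ (insert a B).powerset | P S} : ℝ) - #{S ∈ B.powerset | P S} =
      #{S ∈ (insert a B).powerset | P S ∧ a ∈ S} := by
  have without : {S ∈ (insert a B).powerset | P S ∧ a ∉ S} = {S ∈ B.powerset | P S} := by
    ext S
    simp only [mem_filter, mem_powerset]
    exact ⟨fun h => ⟨(subset_insert_iff_of_notMem h.2.2).1 h.1, h.2.1⟩,
      fun h => ⟨h.1.trans (subset_insert a B), h.2, fun haS => ha (h.1 haS)⟩⟩
  have split := card_filter_add_card_filter_not (s := {S ∈ (insert a B).powerset | P S}) (a ∈ ·)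
  rw [filter_filter, filter_filter, without] at split
  rw [← split]
  simp

open scoped Classical in
theorem shapley_card_subsets (D : Finset F) (P : Finset F → Prop) (α : D) :
    shapley D (fun B => (#{S ∈ B.powerset | P S} : ℝ)) α =
      ∑ S ∈ D.powerset with P S ∧ (α : F) ∈ S, (1 : ℝ) / #S := by
  let below (π : D ≃ Fin #D) : Finset F :=
    (univ.filter fun β : D => π β < π α).map (Function.Embedding.subtype _)
  have subset_insert_below (π : D ≃ Fin #D) (S : Finset F) :
      S ⊆ insert (α : F) (below π) ↔ S ⊆ D ∧ ∀ β ∈ S.subtype (· ∈ D), π β ≤ π α := by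
    have mem_insert_below (x : F) :
        x ∈ insert (α : F) (below π) ↔ ∃ h : x ∈ D, π ⟨x, h⟩ ≤ π α := by
      simp only [below, mem_insert, mem_map, mem_filter_univ, Function.Embedding.subtype_apply]
      constructor
      · rintro (rfl | ⟨β, hβ, rfl⟩)
        exacts [⟨α.2, le_rfl⟩, ⟨β.2, hβ.le⟩]
      · rintro ⟨h, hle⟩
        exact hle.eq_or_lt.imp (fun heq => congrArg Subtype.val (π.injective heq))
          fun hlt => ⟨_, hlt, rfl⟩
    simp only [subset_iff, mem_insert_below, mem_subtype, Subtype.forall]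
    exact ⟨fun h => ⟨fun x hx => (h hx).1, fun x _ hx => (h hx).2⟩,
      fun h x hx => ⟨h.1 hx, h.2 x (h.1 hx) hx⟩⟩
  have marginal (π : D ≃ Fin #D) :
      (#{S ∈ (insert (α : F) (below π)).powerset | P S} : ℝ) - #{S ∈ (below π).powerset | P S} =
        ∑ S ∈ D.powerset with P S ∧ (α : F) ∈ S,
          if ∀ β ∈ S.subtype (· ∈ D), π β ≤ π α then (1 : ℝ) else 0 := by
    rw [card_subsets_insert_sub_card_subsets P (by simp [below]), sum_boole, filter_filter]
    congr 2
    ext S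
    simp only [mem_filter, mem_powerset, subset_insert_below]
    tauto
  rw [shapley, sum_congr rfl fun π _ => marginal π, sum_comm, sum_div]
  refine sum_congr rfl fun S hS => ?_
  obtain ⟨hSD, -, hα⟩ : S ⊆ D ∧ P S ∧ (α : F) ∈ S := by simpa using hS
  have card_subtype_eq : #(S.subtype (· ∈ D)) = #S := by rw [card_subtype, filter_true_of_mem hSD]
  have last := card_equiv_forall_le_mul_card (κ := Fin #D) (S.subtype (· ∈ D)) (a := α) (by simpa)
  have hS : (#S : ℝ) ≠ 0 := Nat.cast_ne_zero.2 (card_ne_zero_of_mem hα)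
  have : Nonempty (D ≃ Fin #D) := ⟨D.equivFin⟩
  rw [sum_boole, div_eq_div_iff (by simp) hS, one_mul, ← last, card_subtype_eq]
  simp

end Shapley

section CriticalTuples

open Finset

variable {F κ : Type*} [DecidableEq F] [Fintype κ] {Sup : Finset F → Prop} {D : Finset F} {α : F}
  {m : ℕ}

theorem image_option_elim (y : κ → F) :
    univ.image (Option.elim · α y) = insert α (univ.image y) := by
  ext x
  simp [Option.exists, eq_comm]

variable [DecidableEq κ]

/-- The components of `z` form a set with property `Sup`, which is lost as soon as a component is
omitted. If `Sup` is inherited by larger sets, these are the repetition-free enumerations of the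
minimal sets with property `Sup`, with a definition that only refers to `Sup` itself. -/
def Critical (Sup : Finset F → Prop) (z : κ → F) : Prop :=
  Sup (univ.image z) ∧ ∀ j, ¬ Sup ((univ.erase j).image z)

theorem Critical.injective {z : κ → F} (h : Critical Sup z) : Function.Injective z := by
  refine fun i j hij => by_contra fun hne => h.2 j ?_
  convert h.1 using 1
  refine (image_subset_image (erase_subset _ _)).antisymm (image_subset_iff.2 fun k _ => ?_)
  by_cases hk : k = j
  · exact mem_image.2 ⟨i, by simp [hne], by rw [hij, hk]⟩
  · exact mem_image_of_mem z (by simp [hk])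

theorem minimal_iff_forall_mem_not_erase (hmono : ∀ S T, S ⊆ T → T ⊆ D → Sup S → Sup T)
    {S : Finset F} (hS : S ⊆ D) : Minimal Sup S ↔ Sup S ∧ ∀ x ∈ S, ¬ Sup (S.erase x) := by
  refine ⟨fun h => ⟨h.prop, fun x hx hsup => ?_⟩, fun h => ⟨h.1, fun T hT hTS x hx => ?_⟩⟩
  · exact notMem_erase x S (h.le_of_le hsup (erase_subset x S) hx)
  · by_contra hxT
    exact h.2 x hx (hmono T _ (subset_erase.2 ⟨hTS, hxT⟩) ((erase_subset x S).trans hS) hT)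

theorem critical_iff_minimal (hmono : ∀ S T, S ⊆ T → T ⊆ D → Sup S → Sup T) {z : κ → F}
    (hz : Function.Injective z) (hzD : ∀ j, z j ∈ D) :
    Critical Sup z ↔ Minimal Sup (univ.image z) := by
  rw [minimal_iff_forall_mem_not_erase hmono (image_subset_iff.2 fun j _ => hzD j)]
  simp [Critical, image_erase hz]

theorem card_tuples_image_eq {T : Finset F} (hTD : T ⊆ D) (hT : #T = Fintype.card κ) :
    #{y : κ → D | univ.image (fun j => (y j : F)) = T} = (Fintype.card κ).factorial := by
  have e : κ ≃ T := Fintype.equivOfCardEq (by simp [hT])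
  rw [← Fintype.card_equiv e, ← card_univ]
  symm
  refine card_bij (fun e _ j => ⟨e j, hTD (e j).2⟩) (fun e _ => ?_) (fun e _ e' _ h => ?_)
    fun y hy => ?_
  · rw [mem_filter_univ]
    ext x
    simpa using ⟨fun ⟨j, hj⟩ => hj ▸ (e j).2, fun hx => ⟨e.symm ⟨x, hx⟩, by simp⟩⟩
  · ext j
    exact congrArg (fun z : κ → D => (z j : F)) h
  · obtain rfl := (mem_filter_univ _).1 hy
    have injective : Function.Injective fun j => (y j : F) := by
      simpa [card_univ] using card_image_iff (s := univ).1 (hT.trans card_univ.symm)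
    have bijective : Function.Bijective fun j =>
        (⟨y j, mem_image_of_mem _ (mem_univ j)⟩ : univ.image fun j => (y j : F)) :=
      (Fintype.bijective_iff_injective_and_card _).2
        ⟨fun i j hij => injective (Subtype.mk.inj hij), by simp [hT]⟩
    exact ⟨.ofBijective _ bijective, mem_univ _, rfl⟩

open scoped Classical in
theorem card_critical (hmono : ∀ S T, S ⊆ T → T ⊆ D → Sup S → Sup T) (hα : α ∈ D) :
    #{y : Fin m → D | Critical Sup fun j : Option (Fin m) => j.elim α fun j => (y j : F)} =
      #{S ∈ D.powerset | (Minimal Sup S ∧ α ∈ S) ∧ #S = m + 1} * m.factorial := by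
  have elim_mem (y : Fin m → D) (j : Option (Fin m)) : j.elim α (fun j => (y j : F)) ∈ D := by
    cases j <;> simp [hα]
  have image_mem (y : Fin m → D)
      (hy : Critical Sup fun j : Option (Fin m) => j.elim α fun j => (y j : F)) :
      insert α (univ.image fun j => (y j : F)) ∈
        ({S ∈ D.powerset | (Minimal Sup S ∧ α ∈ S) ∧ #S = m + 1} : Finset _) := by
    rw [← image_option_elim, mem_filter, mem_powerset,
      ← critical_iff_minimal hmono hy.injective (elim_mem y),
      card_image_of_injective _ hy.injective]
    exact ⟨image_subset_iff.2 fun j _ => elim_mem y j, ⟨hy, by simp [image_option_elim]⟩, by simp⟩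
  rw [card_eq_sum_card_fiberwise fun y hy => image_mem y (by simpa using hy), sum_const_nat]
  intro S hS
  obtain ⟨hSD, ⟨hmin, hαS⟩, hcard⟩ : S ⊆ D ∧ (Minimal Sup S ∧ α ∈ S) ∧ #S = m + 1 := by
    simpa using hS
  have card_erase : #(S.erase α) = Fintype.card (Fin m) := by
    rw [card_erase_of_mem hαS, hcard, Nat.add_sub_cancel, Fintype.card_fin]
  have count := card_tuples_image_eq ((erase_subset α S).trans hSD) card_erase
  rw [Fintype.card_fin] at count
  rw [filter_filter, ← count]
  congr 1
  refine filter_congr fun y _ => ⟨fun ⟨hy, hyS⟩ => ?_, fun hy => ?_⟩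
  · rw [← hyS, erase_insert]
    simpa using fun j hj => Option.some_ne_none j (hy.injective hj)
  · have image_eq : univ.image (fun j : Option (Fin m) => j.elim α fun j => (y j : F)) = S := by
      rw [image_option_elim, hy, insert_erase hαS]
    have injective : Function.Injective fun j : Option (Fin m) => j.elim α fun j => (y j : F) := by
      simpa using card_image_iff (s := univ).1 (by simp [image_eq, hcard])
    refine ⟨(critical_iff_minimal hmono injective (elim_mem y)).2 (image_eq ▸ hmin), ?_⟩
    rw [hy, insert_erase hαS]

open scoped Classical in
theorem sum_one_div_card_minimal (hmono : ∀ S T, S ⊆ T → T ⊆ D → Sup S → Sup T) (hα : α ∈ D)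
    {K : ℕ} (hK : ∀ S, Minimal Sup S → #S ≤ K) :
    ∑ S ∈ D.powerset with Minimal Sup S ∧ α ∈ S, (1 : ℝ) / #S =
      ((∑ m ∈ range K, K.factorial / (m + 1).factorial * #{y : Fin m → D |
        Critical Sup fun j : Option (Fin m) => j.elim α fun j => (y j : F)} : ℕ) : ℝ) /
        K.factorial := by
  have card_mem_range : ∀ S ∈ ({S ∈ D.powerset | Minimal Sup S ∧ α ∈ S} : Finset _),
      #S - 1 ∈ range K := by
    intro S hS
    obtain ⟨-, hmin, hαS⟩ := mem_filter.1 hS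
    have := hK S hmin
    have := card_pos.2 ⟨α, hαS⟩
    exact mem_range.2 (by omega)
  rw [← sum_fiberwise_of_maps_to card_mem_range, Nat.cast_sum, sum_div]
  refine sum_congr rfl fun m hm => ?_
  have fiber_eq : ({S ∈ ({S ∈ D.powerset | Minimal Sup S ∧ α ∈ S} : Finset _) | #S - 1 = m}) =
      {S ∈ D.powerset | (Minimal Sup S ∧ α ∈ S) ∧ #S = m + 1} := by
    rw [filter_filter]
    refine filter_congr fun S _ => and_congr_right fun h => ?_
    have := card_pos.2 ⟨α, h.2⟩
    omega
  have term_eq : ∀ S ∈ ({S ∈ D.powerset | (Minimal Sup S ∧ α ∈ S) ∧ #S = m + 1} : Finset _),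
      (1 : ℝ) / #S = 1 / (m + 1 : ℕ) := fun S hS => by rw [(mem_filter.1 hS).2.2]
  rw [fiber_eq, card_critical hmono hα, sum_congr rfl term_eq, sum_const, nsmul_eq_mul,
    Nat.cast_mul, Nat.cast_div (Nat.factorial_dvd_factorial (mem_range.1 hm)) (by positivity),
    Nat.cast_mul, Nat.factorial_succ m, Nat.cast_mul]
  have : (K.factorial : ℝ) ≠ 0 := by positivity
  have : (m.factorial : ℝ) ≠ 0 := by positivity
  have : ((m + 1 : ℕ) : ℝ) ≠ 0 := by positivity
  field_simp

end CriticalTuples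

section Supports

open Finset

variable {σ : Schema} {Const Var : Type*}

theorem Atom.sign_injective {T : Type*} (e : Sgn) :
    Function.Injective (Atom.sign e : Atom σ T → Atom σ.signed T) := by
  rintro ⟨R, t⟩ ⟨R', t'⟩ h
  cases h
  rfl

theorem Atom.sign_plus_ne_sign_minus {T : Type*} (a b : Atom σ T) :
    a.sign .plus ≠ b.sign .minus :=
  fun h => nomatch congrArg (fun c : Atom σ.signed T => c.rel.1) h

theorem Atom.sign_plus_mem {T : Type*} {A B : Set (Atom σ T)} {a : Atom σ T} :
    a.sign .plus ∈ Atom.sign .plus '' A ∪ Atom.sign .minus '' B ↔ a ∈ A := by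
  simp [(Atom.sign_injective .plus).mem_set_image, (Atom.sign_plus_ne_sign_minus _ _).symm]

theorem Atom.sign_minus_mem {T : Type*} {A B : Set (Atom σ T)} {a : Atom σ T} :
    a.sign .minus ∈ Atom.sign .plus '' A ∪ Atom.sign .minus '' B ↔ a ∈ B := by
  simp [(Atom.sign_injective .minus).mem_set_image, Atom.sign_plus_ne_sign_minus]

variable {q : UCQNeg σ Const Var} {D S T : Finset (Fact σ Const)}

theorem isPositiveSupport_iff : IsPositiveSupport q D S ↔ S ⊆ D ∧ ∃ p ∈ q, ∃ ν : Var → Const,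
    (∀ a ∈ p.pos, a.map (Term.eval ν) ∈ S) ∧ (∀ a ∈ p.neg, a.map (Term.eval ν) ∈ negFacts D) ∧
      ∀ e ∈ p.ineq, e.1.eval ν ≠ e.2.eval ν := by
  have map_sign (e : Sgn) (a : Atom σ (Term Const Var)) (ν : Var → Const) :
      (a.sign e).map (Term.eval ν) = (a.map (Term.eval ν)).sign e := rfl
  refine and_congr_right fun _ => ?_
  simp only [UCQNeg.Sat, UCQNeg.signed, List.mem_map, exists_exists_and_eq_and, CQNeg.Sat,
    CQNeg.signed, List.mem_append, or_imp, forall_and, forall_exists_index, and_imp,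
    forall_apply_eq_imp_iff₂, map_sign, Atom.sign_plus_mem, Atom.sign_minus_mem, and_assoc]
  simp

theorem IsPositiveSupport.mono (hST : S ⊆ T) (hT : T ⊆ D) (h : IsPositiveSupport q D S) :
    IsPositiveSupport q D T := by
  rw [isPositiveSupport_iff] at h ⊢
  obtain ⟨-, p, hp, ν, hpos, hrest⟩ := h
  exact ⟨hT, p, hp, ν, fun a ha => hST (hpos a ha), hrest⟩

/-- The total number of positive atoms of a query, a bound for the size of its minimal positive
supports. -/
def UCQNeg.width (q : UCQNeg σ Const Var) : ℕ :=
  (q.map fun p => p.pos.length).sum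

theorem IsMinimalPositiveSupport.card_le (h : IsMinimalPositiveSupport q D S) :
    #S ≤ q.width := by
  classical
  obtain ⟨hSD, p, hp, ν, hpos, hrest⟩ := isPositiveSupport_iff.1 h.prop
  let matched : Finset (Fact σ Const) := (p.pos.map fun a => a.map (Term.eval ν)).toFinset
  have matched_subset : matched ⊆ S := fun f hf => by
    obtain ⟨a, ha, rfl⟩ : ∃ a ∈ p.pos, a.map (Term.eval ν) = f := by simpa [matched] using hf
    exact hpos a ha
  have subset_matched : S ⊆ matched := h.le_of_le (isPositiveSupport_iff.2
    ⟨matched_subset.trans hSD, p, hp, ν, fun a ha =>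
      List.mem_toFinset.2 (List.mem_map_of_mem ha), hrest⟩) matched_subset
  calc #S ≤ #matched := card_le_card subset_matched
    _ ≤ p.pos.length := (List.toFinset_card_le _).trans_eq (List.length_map _)
    _ ≤ q.width := List.single_le_sum (by simp) _ (List.mem_map_of_mem hp)

end Supports

/-! ### Encodings of databases -/

section Words

/-- The word `w` occurs in `s` immediately after the end of a word. -/
def OccursAfterWord (s : List Sym) (w : List Bool) : Prop :=
  .endWord :: encodeWord w <:+: s

theorem encodeWord_injective : Function.Injective encodeWord := fun _ _ h =>
  List.map_injective_iff.2 (fun _ _ => Sym.bit.inj) (List.append_cancel_right h)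

theorem piece_encodeWord_append (w : List Bool) (s : List Sym) :
    piece (encodeWord w ++ s) = encodeWord w := by
  induction w with
  | nil => rfl
  | cons b w ih => exact congrArg (Sym.bit b :: ·) ih

theorem afterPiece_encodeWord_append (w : List Bool) (s : List Sym) :
    afterPiece (encodeWord w ++ s) = s := by
  induction w with
  | nil => rfl
  | cons _ _ ih => exact ih

theorem pieceAt_encodeWords_append (ws : List (List Bool)) (s : List Sym) (k : ℕ)
    (hk : k < ws.length) :
    pieceAt k ((ws.map encodeWord).flatten ++ s) = encodeWord ws[k] := by
  induction ws generalizing k with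
  | nil => simp at hk
  | cons w ws ih =>
    cases k with
    | zero => simp [pieceAt, piece_encodeWord_append]
    | succ k =>
      simpa [pieceAt, afterPiece_encodeWord_append] using ih k (by simpa using hk)

theorem encodeWord_prefix_iff {w : List Bool} {s : List Sym} :
    encodeWord w <+: s ↔ piece s = encodeWord w := by
  refine ⟨?_, fun h => ⟨afterPiece s, h ▸ piece_append_afterPiece s⟩⟩
  rintro ⟨t, rfl⟩
  exact piece_encodeWord_append w t

theorem occursAfterWord_iff_exists_position {s : List Sym} {w : List Bool} :
    OccursAfterWord s w ↔ ∃ p < s.length,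
      (s.take p).getLast? = some .endWord ∧ pieceAt 0 (s.drop p) = encodeWord w := by
  simp only [pieceAt, Function.iterate_zero, id, ← encodeWord_prefix_iff]
  constructor
  · rintro ⟨u, v, rfl⟩
    refine ⟨u.length + 1, ?_, ?_⟩
    · simp [encodeWord]
    · simp [List.take_append, List.getLast?_append]
  · rintro ⟨p, -, hlast, v, hv⟩
    obtain ⟨u, hu⟩ := List.getLast?_eq_some_iff.1 hlast
    refine ⟨u, v, ?_⟩
    rw [← List.take_append_drop p s, hu, ← hv]
    simp

theorem occursAfterWord_cons {c : Sym} {s : List Sym} {w : List Bool} :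
    OccursAfterWord (c :: s) w ↔ c = .endWord ∧ piece s = encodeWord w ∨ OccursAfterWord s w := by
  rw [OccursAfterWord, List.infix_cons_iff, List.cons_prefix_cons, encodeWord_prefix_iff, eq_comm,
    OccursAfterWord]

theorem occursAfterWord_encodeWord_append {v w : List Bool} {s : List Sym} :
    OccursAfterWord (encodeWord v ++ s) w ↔ piece s = encodeWord w ∨ OccursAfterWord s w := by
  induction v with
  | nil => simp [encodeWord, occursAfterWord_cons]
  | cons b v ih =>
    rw [← ih]
    simp [encodeWord, occursAfterWord_cons]

theorem occursAfterWord_encodeWords_append {v : List Bool} {ws : List (List Bool)} {s : List Sym}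
    {w : List Bool} :
    OccursAfterWord (encodeWord v ++ ((ws.map encodeWord).flatten ++ .endFact :: s)) w ↔
      w ∈ ws ∨ OccursAfterWord s w := by
  induction ws generalizing v with
  | nil =>
    have : piece (.endFact :: s) ≠ encodeWord w := by
      cases w <;> simp [piece, encodeWord, Sym.isBit]
    simp [occursAfterWord_encodeWord_append, occursAfterWord_cons, this]
  | cons u ws ih =>
    rw [occursAfterWord_encodeWord_append, List.map_cons, List.flatten_cons, List.append_assoc, ih,
      piece_encodeWord_append, encodeWord_injective.eq_iff, List.mem_cons, or_assoc, eq_comm]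

end Words

section Facts

variable {σ : Schema} {Const : Type} {relName : σ.Rel ↪ List Bool} {constName : Const ↪ List Bool}
  {l : List Sym} {f g : Fact σ Const}

/-- The names of the arguments of a fact. -/
def argWords (constName : Const ↪ List Bool) (f : Fact σ Const) : List (List Bool) :=
  List.ofFn fun i => constName (f.args i)

theorem encodeFact_append (s : List Sym) :
    encodeFact relName constName f ++ s = encodeWord (relName f.rel) ++
      (((argWords constName f).map encodeWord).flatten ++ .endFact :: s) := by
  simp [encodeFact, argWords, List.map_ofFn, Function.comp_def]

theorem pieceAt_zero_of_prefix (h : encodeFact relName constName f <+: l) :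
    pieceAt 0 l = encodeWord (relName f.rel) := by
  obtain ⟨s, rfl⟩ := h
  rw [encodeFact_append]
  exact piece_encodeWord_append _ _

theorem pieceAt_succ_of_prefix (h : encodeFact relName constName f <+: l)
    (i : Fin (σ.arity f.rel)) : pieceAt (i + 1) l = encodeWord (constName (f.args i)) := by
  obtain ⟨s, rfl⟩ := h
  rw [encodeFact_append, pieceAt, Function.iterate_succ_apply, afterPiece_encodeWord_append,
    ← pieceAt, pieceAt_encodeWords_append _ _ _ (by simp [argWords])]
  simp [argWords]

theorem eq_iff_pieceAt_of_prefix (h : encodeFact relName constName f <+: l) :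
    f = g ↔ pieceAt 0 l = encodeWord (relName g.rel) ∧
      ∀ i : Fin (σ.arity g.rel), pieceAt (i + 1) l = encodeWord (constName (g.args i)) := by
  constructor
  · rintro rfl
    exact ⟨pieceAt_zero_of_prefix h, pieceAt_succ_of_prefix h⟩
  · rintro ⟨hrel, hargs⟩
    rw [pieceAt_zero_of_prefix h] at hrel
    obtain ⟨R, a⟩ := f
    obtain ⟨R', a'⟩ := g
    obtain rfl : R = R' := relName.injective (encodeWord_injective hrel)
    congr 1
    funext i
    exact constName.injective
      (encodeWord_injective ((pieceAt_succ_of_prefix h i).symm.trans (hargs i)))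

theorem exists_pieceAt_succ_eq_encodeWord (h : encodeFact relName constName f <+: l) {R : σ.Rel}
    (hR : pieceAt 0 l = encodeWord (relName R)) (i : Fin (σ.arity R)) :
    ∃ c, pieceAt (i + 1) l = encodeWord (constName c) := by
  rw [pieceAt_zero_of_prefix h] at hR
  obtain rfl := relName.injective (encodeWord_injective hR)
  exact ⟨_, pieceAt_succ_of_prefix h i⟩

end Facts

section Databases

variable {σ : Schema} {Const : Type} {relName : σ.Rel ↪ List Bool} {constName : Const ↪ List Bool}
  {T : List (Fact σ Const)} {f g : Fact σ Const} {p p' : ℕ}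

/-- The concatenation of the encodings of the facts in a list. -/
def encodeFacts (relName : σ.Rel ↪ List Bool) (constName : Const ↪ List Bool)
    (T : List (Fact σ Const)) : List Sym :=
  (T.map (encodeFact relName constName)).flatten

theorem encodeFacts_append (T T' : List (Fact σ Const)) :
    encodeFacts relName constName (T ++ T') =
      encodeFacts relName constName T ++ encodeFacts relName constName T' := by
  simp [encodeFacts]

theorem encodeFacts_cons : encodeFacts relName constName (f :: T) =
    encodeFact relName constName f ++ encodeFacts relName constName T := rfl

/-- No fact is under way at the position `p` of `s`, which holds at the beginning of `s` and after
the end of every fact. -/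
def IsStart (s : List Sym) (p : ℕ) : Prop :=
  ∀ c ∈ (s.take p).getLast?, c = .endFact

theorem isStart_encodeFact_append_of_lt {s : List Sym}
    (hp : p < (encodeFact relName constName f).length) :
    IsStart (encodeFact relName constName f ++ s) p ↔ p = 0 := by
  rw [encodeFact] at hp ⊢
  set u := encodeWord (relName f.rel) ++
    (List.ofFn fun i => encodeWord (constName (f.args i))).flatten
  have endFact_notMem : Sym.endFact ∉ u := by simp [u, encodeWord]
  have hpu : p ≤ u.length := by simpa using Nat.le_of_lt_succ (by simpa using hp)
  rw [IsStart, List.append_assoc, List.take_append_of_le_length hpu]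
  refine ⟨fun h => by_contra fun hp₀ => ?_, fun h => by simp [h]⟩
  have hne : u.take p ≠ [] := by
    rw [ne_eq, ← List.length_eq_zero_iff, List.length_take, min_eq_left hpu]
    exact hp₀
  refine endFact_notMem (List.mem_of_mem_take (i := p) ?_)
  rw [← h _ (List.getLast?_eq_some_getLast hne)]
  exact List.getLast_mem hne

theorem isStart_encodeFact_append_add {s : List Sym} :
    IsStart (encodeFact relName constName f ++ s) ((encodeFact relName constName f).length + p) ↔
      IsStart s p := by
  have last : (encodeFact relName constName f).getLast? = some .endFact := by simp [encodeFact]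
  rw [IsStart, List.take_length_add_append, List.getLast?_append, last, IsStart]
  cases (s.take p).getLast? <;> simp

/-- The fact `f` of the list `T` begins at the position `p` of the encoding of `T`. -/
def FactAt (relName : σ.Rel ↪ List Bool) (constName : Const ↪ List Bool) (T : List (Fact σ Const))
    (p : ℕ) (f : Fact σ Const) : Prop :=
  ∃ i : ℕ, T[i]? = some f ∧ p = (encodeFacts relName constName (T.take i)).length

theorem factAt_cons_iff : FactAt relName constName (f :: T) p g ↔ p = 0 ∧ f = g ∨
    ∃ p', p = (encodeFact relName constName f).length + p' ∧ FactAt relName constName T p' g := by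
  constructor
  · rintro ⟨_ | i, hi, hp⟩
    · exact .inl ⟨hp, by simpa using hi⟩
    · exact .inr ⟨_, by simpa [encodeFacts_cons] using hp, i, by simpa using hi, rfl⟩
  · rintro (⟨rfl, rfl⟩ | ⟨_, rfl, i, hi, rfl⟩)
    · exact ⟨0, rfl, rfl⟩
    · exact ⟨i + 1, by simpa using hi, by simp [encodeFacts_cons]⟩

theorem isStart_iff_exists_factAt :
    p < (encodeFacts relName constName T).length ∧ IsStart (encodeFacts relName constName T) p ↔
      ∃ f, FactAt relName constName T p f := by
  induction T generalizing p with
  | nil => simp [encodeFacts, FactAt]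
  | cons f T ih =>
    have length_pos : 0 < (encodeFact relName constName f).length := by simp [encodeFact]
    simp only [factAt_cons_iff, encodeFacts_cons]
    obtain hp | hp := Nat.lt_or_ge p (encodeFact relName constName f).length
    · have hp' (p' : ℕ) : p ≠ (encodeFact relName constName f).length + p' := by omega
      simp [isStart_encodeFact_append_of_lt hp, hp', Nat.lt_add_right _ hp]
    · obtain ⟨p, rfl⟩ := Nat.exists_eq_add_of_le hp
      simp [isStart_encodeFact_append_add, ih, length_pos.ne']

theorem FactAt.mem (h : FactAt relName constName T p f) : f ∈ T :=
  have ⟨_, hi, _⟩ := h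
  List.mem_of_getElem? hi

theorem exists_factAt (h : f ∈ T) : ∃ p, FactAt relName constName T p f :=
  have ⟨i, hi⟩ := List.mem_iff_getElem?.1 h
  ⟨_, i, hi, rfl⟩

theorem FactAt.prefix_drop (h : FactAt relName constName T p f) :
    encodeFact relName constName f <+: (encodeFacts relName constName T).drop p := by
  obtain ⟨i, hi, rfl⟩ := h
  obtain ⟨hlt, rfl⟩ := List.getElem?_eq_some_iff.1 hi
  have decomposition : encodeFacts relName constName T = encodeFacts relName constName (T.take i) ++
      (encodeFact relName constName T[i] ++ encodeFacts relName constName (T.drop (i + 1))) := by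
    rw [← encodeFacts_cons, ← List.drop_eq_getElem_cons, ← encodeFacts_append,
      List.take_append_drop]
  rw [decomposition, List.drop_left]
  exact List.prefix_append _ _

theorem FactAt.unique (hf : FactAt relName constName T p f) (hg : FactAt relName constName T p g) :
    f = g :=
  (eq_iff_pieceAt_of_prefix hf.prefix_drop).2
    ⟨pieceAt_zero_of_prefix hg.prefix_drop, pieceAt_succ_of_prefix hg.prefix_drop⟩

theorem FactAt.position_unique (hT : T.Nodup) (h : FactAt relName constName T p f)
    (h' : FactAt relName constName T p' f) : p = p' := by
  obtain ⟨i, hi, rfl⟩ := h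
  obtain ⟨j, hj, rfl⟩ := h'
  rw [(List.getElem?_inj (List.getElem?_eq_some_iff.1 hi).1 hT).1 (hi.trans hj.symm)]

theorem occursAfterWord_encodeFacts {w : List Bool} :
    OccursAfterWord (encodeFacts relName constName T) w ↔
      ∃ f ∈ T, ∃ i, constName (f.args i) = w := by
  induction T with
  | nil => simp [encodeFacts, OccursAfterWord]
  | cons f T ih =>
    rw [encodeFacts_cons, encodeFact_append, occursAfterWord_encodeWords_append, ih]
    simp [argWords, List.mem_ofFn]

end Databases

/-! ### Evaluation of queries by pointers -/

section Queries

open Prog Function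

variable {σ : Schema} {Const : Type} {Var : Type*}

/-- The variable `y` occurs in a positive atom, as safety demands of the variables of negated atoms
and inequalities. -/
def CQNeg.Binds (p : CQNeg σ Const Var) (y : Var) : Prop :=
  ∃ b ∈ p.pos, b.HasVar y

variable {p : CQNeg σ Const Var} {y : Var}

theorem CQNeg.Binds.exists_args_get_eq (hy : p.Binds y) :
    ∃ (u : Fin p.pos.length) (i : Fin (σ.arity (p.pos.get u).rel)),
      (p.pos.get u).args i = .var y := by
  obtain ⟨b, hb, hy⟩ := hy
  obtain ⟨u, rfl⟩ := List.get_of_mem hb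
  exact ⟨u, hy⟩

theorem CQNeg.forall_args_mem_activeDomain_iff {D : Finset (Fact σ Const)} {ν : Var → Const}
    (hpos : ∀ b ∈ p.pos, b.map (Term.eval ν) ∈ D) {a : Atom σ (Term Const Var)} (ha : a ∈ p.neg) :
    (∀ i, (a.map (Term.eval ν)).args i ∈ activeDomain D) ↔
      ∀ i c, a.args i = .const c → c ∈ activeDomain D := by
  refine forall_congr' fun i => ?_
  change (a.args i).eval ν ∈ _ ↔ _
  cases h : a.args i with
  | const c => simp [Term.eval]
  | var y =>
    obtain ⟨b, hb, j, hj⟩ := p.safe_neg a ha y ⟨i, h⟩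
    have value_mem : (Term.var y).eval ν ∈ activeDomain D :=
      ⟨_, hpos b hb, j, congrArg (Term.eval ν) hj⟩
    simpa using value_mem

variable (relName : σ.Rel ↪ List Bool) (constName : Const ↪ List Bool) {ι : Type}

open scoped Classical in
/-- Where the name of the value of a term can be read off when the positive atom with number `u` is
matched to the fact at the pointer `ptr u`. The junk value for a variable that occurs in no positive
atom is never read, by safety. -/
noncomputable def CQNeg.ref (p : CQNeg σ Const Var) (ptr : Fin p.pos.length → ι) :
    Term Const Var → Ref ι
  | .const c => .word (encodeWord (constName c))
  | .var y => if hy : p.Binds y then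
      .piece (ptr hy.exists_args_get_eq.choose) (hy.exists_args_get_eq.choose_spec.choose + 1)
    else .word []

/-- The fact at the pointer `i` is an instance of the atom `a`, for the values of the variables
given by the pointers `ptr`. -/
def CQNeg.MatchesAt (p : CQNeg σ Const Var) (ptr : Fin p.pos.length → ι) (i : ι)
    (a : Atom σ (Term Const Var)) (s : List Sym) (x : ι → ℕ) : Prop :=
  pieceAt 0 (s.drop (x i)) = encodeWord (relName a.rel) ∧ ∀ j : Fin (σ.arity a.rel),
    pieceAt (j + 1) (s.drop (x i)) = (p.ref constName ptr (a.args j)).val s x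

/-- The values of the variables given by the pointers `ptr` are those of the valuation `ν`. -/
def CQNeg.Compatible (p : CQNeg σ Const Var) (ptr : Fin p.pos.length → ι) (s : List Sym)
    (x : ι → ℕ) (ν : Var → Const) : Prop :=
  ∀ y, p.Binds y → (p.ref constName ptr (.var y)).val s x = encodeWord (constName (ν y))

section Valuations

variable {relName constName} {ptr : Fin p.pos.length → ι} {ν : Var → Const} {s : List Sym}
  {x : ι → ℕ}

theorem CQNeg.exists_ref_var_eq (hy : p.Binds y) :
    ∃ (u : Fin p.pos.length) (i : Fin (σ.arity (p.pos.get u).rel)),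
      (p.pos.get u).args i = .var y ∧ p.ref constName ptr (.var y) = .piece (ptr u) (i + 1) :=
  ⟨_, _, hy.exists_args_get_eq.choose_spec.choose_spec, dif_pos hy⟩

theorem CQNeg.Compatible.ref_val (hν : p.Compatible constName ptr s x ν) {t : Term Const Var}
    (ht : ∀ y, t = .var y → p.Binds y) :
    (p.ref constName ptr t).val s x = encodeWord (constName (t.eval ν)) := by
  cases t with
  | const c => rfl
  | var y => exact hν y (ht y rfl)

theorem CQNeg.Compatible.matchesAt_iff (hν : p.Compatible constName ptr s x ν) {i : ι}
    {f : Fact σ Const} (hf : encodeFact relName constName f <+: s.drop (x i))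
    {a : Atom σ (Term Const Var)} (ha : ∀ y, a.HasVar y → p.Binds y) :
    p.MatchesAt relName constName ptr i a s x ↔ f = a.map (Term.eval ν) := by
  rw [eq_iff_pieceAt_of_prefix hf]
  refine and_congr Iff.rfl (forall_congr' fun j => ?_)
  rw [hν.ref_val fun y hy => ha y ⟨j, hy⟩]
  rfl

theorem CQNeg.exists_compatible [Nonempty Const] {F : ι → Fact σ Const}
    (hF : ∀ u, encodeFact relName constName (F (ptr u)) <+: s.drop (x (ptr u)))
    (h : ∀ u, p.MatchesAt relName constName ptr (ptr u) (p.pos.get u) s x) :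
    ∃ ν, p.Compatible constName ptr s x ν := by
  have exists_value (y : Var) : ∃ c, p.Binds y →
      (p.ref constName ptr (.var y)).val s x = encodeWord (constName c) := by
    by_cases hy : p.Binds y
    · obtain ⟨u, i, -, ref_eq⟩ := p.exists_ref_var_eq (constName := constName) (ptr := ptr) hy
      obtain ⟨c, hc⟩ := exists_pieceAt_succ_eq_encodeWord (hF u) (h u).1 i
      exact ⟨c, fun _ => by rw [ref_eq]; exact hc⟩
    · exact ⟨Classical.arbitrary _, fun h => absurd h hy⟩
  choose ν hν using exists_value
  exact ⟨ν, hν⟩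

theorem CQNeg.compatible_of_eq_map {F : ι → Fact σ Const}
    (hF : ∀ u, encodeFact relName constName (F (ptr u)) <+: s.drop (x (ptr u)))
    (h : ∀ u, F (ptr u) = (p.pos.get u).map (Term.eval ν)) :
    p.Compatible constName ptr s x ν := by
  intro y hy
  obtain ⟨u, i, hi, ref_eq⟩ := p.exists_ref_var_eq (constName := constName) (ptr := ptr) hy
  rw [ref_eq]
  refine (((eq_iff_pieceAt_of_prefix (hF u)).1 (h u)).2 i).trans ?_
  simp only [Atom.map, hi, Term.eval]

end Valuations

variable [DecidableEq ι]

/-- Matching the positive atoms of `p` to the facts at the pointers `ptr` satisfies `p`. The pointer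
`scratch` is used for going through all facts of the database in search of an instance of a negated
atom, and the condition on the constants of negated atoms says that they are in the active domain;
the variables are bound to constants of the active domain anyway. -/
def CQNeg.Witnessed (scratch : ι) (p : CQNeg σ Const Var) (ptr : Fin p.pos.length → ι)
    (s : List Sym) (x : ι → ℕ) : Prop :=
  (∀ u, p.MatchesAt relName constName ptr (ptr u) (p.pos.get u) s x) ∧
  (∀ a ∈ p.neg, (∀ j c, a.args j = .const c → OccursAfterWord s (constName c)) ∧
    ¬ ∃ k < s.length, IsStart s k ∧
      p.MatchesAt relName constName ptr scratch a s (update x scratch k)) ∧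
  ∀ e ∈ p.ineq, ¬ (p.ref constName ptr e.1).val s x = (p.ref constName ptr e.2).val s x

/-- The facts at the pointers in `J` form a positive support. -/
def SupportedBy (scratch : ι) (q : UCQNeg σ Const Var) (J : Finset ι) (s : List Sym)
    (x : ι → ℕ) : Prop :=
  ∃ p ∈ q, ∃ ptr : Fin p.pos.length → J,
    p.Witnessed relName constName scratch (fun u => ptr u) s x

section Decidability

variable {relName constName} {C : (ι → ℕ) → Prop}

theorem polyDecidable_isStart (i : ι) : PolyDecidable C fun s x => IsStart s (x i) :=
  (polyDecidable_getLast?_take i fun o => decide (∀ c ∈ o, c = .endFact)).congr fun s x _ => by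
    simp [IsStart]

theorem polyDecidable_occursAfterWord {scratch : ι} (hC : ∀ x, C x → x scratch = 0)
    (w : List Bool) : PolyDecidable C fun s _ => OccursAfterWord s w := by
  have found_at : PolyDecidable (fun _ => True) fun s (x : ι → ℕ) =>
      decide ((s.take (x scratch)).getLast? = some .endWord) = true ∧
        (Ref.piece scratch 0).val s x = (Ref.word (encodeWord w) : Ref ι).val s x :=
    (polyDecidable_getLast?_take scratch fun o => decide (o = some .endWord)).and
      (polyDecidable_eq _ _)
  exact (found_at.exists_position hC fun _ _ _ => trivial).congr fun s x _ => by
    simp [occursAfterWord_iff_exists_position, Ref.val]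

theorem polyDecidable_matchesAt (p : CQNeg σ Const Var) (ptr : Fin p.pos.length → ι) (i : ι)
    (a : Atom σ (Term Const Var)) : PolyDecidable C (p.MatchesAt relName constName ptr i a) :=
  (polyDecidable_eq (.piece i 0) (.word _)).and
    (.forall fun j => polyDecidable_eq (.piece i (j + 1)) _)

theorem polyDecidable_witnessed {scratch : ι} (hC : ∀ x, C x → x scratch = 0)
    (p : CQNeg σ Const Var) (ptr : Fin p.pos.length → ι) :
    PolyDecidable C (p.Witnessed relName constName scratch ptr) := by
  refine (PolyDecidable.forall fun u => polyDecidable_matchesAt p ptr _ _).and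
    ((PolyDecidable.forall_mem _ fun a _ => .and (.forall fun j => ?_) (.not ?_)).and
      (.forall_mem _ fun e _ => (polyDecidable_eq _ _).not))
  · cases h : a.args j with
    | const c => exact (polyDecidable_occursAfterWord hC (constName c)).congr fun s x _ => by simp
    | var y => exact (PolyDecidable.const True).congr fun s x _ => by simp
  · have instance_at : PolyDecidable (fun _ => True) fun s x =>
        IsStart s (x scratch) ∧ p.MatchesAt relName constName ptr scratch a s x :=
      (polyDecidable_isStart scratch).and (polyDecidable_matchesAt p ptr scratch a)
    exact (instance_at.exists_position hC fun _ _ _ => trivial).congr fun s x _ => by simp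

theorem polyDecidable_supportedBy {scratch : ι} (hC : ∀ x, C x → x scratch = 0)
    (q : UCQNeg σ Const Var) (J : Finset ι) :
    PolyDecidable C (SupportedBy relName constName scratch q J) :=
  .exists_mem q fun p _ => .exists fun ptr => polyDecidable_witnessed hC p fun u => ptr u

end Decidability

section Correctness

variable {relName constName} {ptr : Fin p.pos.length → ι} {ν : Var → Const} {s : List Sym}
  {x : ι → ℕ} {T : List (Fact σ Const)} {D : Finset (Fact σ Const)} {scratch : ι}

theorem CQNeg.Compatible.update (hν : p.Compatible constName ptr s x ν)
    (hptr : ∀ u, ptr u ≠ scratch) (k : ℕ) :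
    p.Compatible constName ptr s (update x scratch k) ν := by
  intro y hy
  rw [← hν y hy]
  obtain ⟨u, i, -, ref_eq⟩ := p.exists_ref_var_eq (constName := constName) (ptr := ptr) hy
  simp [ref_eq, Ref.val, hptr u]

theorem CQNeg.Compatible.exists_matchesAt_iff
    (hν : p.Compatible constName ptr (encodeFacts relName constName T) x ν)
    (hptr : ∀ u, ptr u ≠ scratch) {a : Atom σ (Term Const Var)}
    (ha : ∀ y, a.HasVar y → p.Binds y) :
    (∃ k < (encodeFacts relName constName T).length, IsStart (encodeFacts relName constName T) k ∧
        p.MatchesAt relName constName ptr scratch a (encodeFacts relName constName T)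
          (Function.update x scratch k)) ↔ a.map (Term.eval ν) ∈ T := by
  have matches_iff {k : ℕ} {f : Fact σ Const} (hf : FactAt relName constName T k f) :
      p.MatchesAt relName constName ptr scratch a (encodeFacts relName constName T)
        (Function.update x scratch k) ↔ f = a.map (Term.eval ν) :=
    (hν.update hptr k).matchesAt_iff (by simpa using hf.prefix_drop) ha
  constructor
  · rintro ⟨k, hk, hstart, hmatch⟩
    obtain ⟨f, hf⟩ := isStart_iff_exists_factAt.1 ⟨hk, hstart⟩
    exact (matches_iff hf).1 hmatch ▸ hf.mem
  · intro hmem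
    obtain ⟨k, hf⟩ := exists_factAt (relName := relName) (constName := constName) hmem
    obtain ⟨hk, hstart⟩ := isStart_iff_exists_factAt.2 ⟨_, hf⟩
    exact ⟨k, hk, hstart, (matches_iff hf).2 rfl⟩

theorem CQNeg.Compatible.witnessed_iff
    (hν : p.Compatible constName ptr (encodeFacts relName constName T) x ν)
    (hptr : ∀ u, ptr u ≠ scratch) (hD : ∀ f, f ∈ D ↔ f ∈ T) {F : ι → Fact σ Const}
    (hF : ∀ u, FactAt relName constName T (x (ptr u)) (F (ptr u))) :
    p.Witnessed relName constName scratch ptr (encodeFacts relName constName T) x ↔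
      (∀ u, F (ptr u) = (p.pos.get u).map (Term.eval ν)) ∧
      (∀ a ∈ p.neg, a.map (Term.eval ν) ∈ negFacts D) ∧
      ∀ e ∈ p.ineq, e.1.eval ν ≠ e.2.eval ν := by
  refine (and_congr_left' (forall_congr' fun u =>
    hν.matchesAt_iff (hF u).prefix_drop fun y hy => ⟨_, p.pos.get_mem u, hy⟩)).trans
    (and_congr_right fun hpos => and_congr (forall₂_congr fun a ha => ?_)
      (forall₂_congr fun e he => not_congr ?_))
  · have hposD : ∀ b ∈ p.pos, b.map (Term.eval ν) ∈ D := fun b hb => by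
      obtain ⟨u, rfl⟩ := List.get_of_mem hb
      exact hpos u ▸ (hD _).2 (hF u).mem
    refine and_congr (.trans ?_ (CQNeg.forall_args_mem_activeDomain_iff hposD ha).symm)
      (not_congr ((hν.exists_matchesAt_iff hptr (p.safe_neg a ha)).trans (hD _).symm))
    simp only [occursAfterWord_encodeFacts, constName.injective.eq_iff, activeDomain, hD,
      Set.mem_ofPred_eq]
  · rw [hν.ref_val fun y hy => p.safe_ineq e he y (.inl hy),
      hν.ref_val fun y hy => p.safe_ineq e he y (.inr hy),
      encodeWord_injective.eq_iff, constName.injective.eq_iff]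

theorem CQNeg.witnessed_iff [Nonempty Const] (hptr : ∀ u, ptr u ≠ scratch)
    (hD : ∀ f, f ∈ D ↔ f ∈ T) {F : ι → Fact σ Const}
    (hF : ∀ u, FactAt relName constName T (x (ptr u)) (F (ptr u))) :
    p.Witnessed relName constName scratch ptr (encodeFacts relName constName T) x ↔
      ∃ ν : Var → Const, (∀ u, F (ptr u) = (p.pos.get u).map (Term.eval ν)) ∧
        (∀ a ∈ p.neg, a.map (Term.eval ν) ∈ negFacts D) ∧
        ∀ e ∈ p.ineq, e.1.eval ν ≠ e.2.eval ν := by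
  have encoded_at (u : Fin p.pos.length) := (hF u).prefix_drop
  constructor
  · intro h
    obtain ⟨ν, hν⟩ := CQNeg.exists_compatible encoded_at h.1
    exact ⟨ν, (hν.witnessed_iff hptr hD hF).1 h⟩
  · rintro ⟨ν, h⟩
    exact ((CQNeg.compatible_of_eq_map encoded_at h.1).witnessed_iff hptr hD hF).2 h

theorem supportedBy_iff [DecidableEq (Fact σ Const)] [Nonempty Const] {q : UCQNeg σ Const Var}
    (hD : ∀ f, f ∈ D ↔ f ∈ T) {J : Finset ι} (hJ : scratch ∉ J) {F : ι → Fact σ Const}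
    (hF : ∀ i ∈ J, FactAt relName constName T (x i) (F i)) :
    SupportedBy relName constName scratch q J (encodeFacts relName constName T) x ↔
      IsPositiveSupport q D (J.image F) := by
  have image_subset : J.image F ⊆ D :=
    Finset.image_subset_iff.2 fun i hi => (hD _).2 (hF i hi).mem
  rw [isPositiveSupport_iff, and_iff_right image_subset]
  refine exists_congr fun p => and_congr_right fun _ => ?_
  simp only [fun ptr : Fin p.pos.length → J => CQNeg.witnessed_iff (ptr := fun u => (ptr u : ι))
    (fun u => ne_of_mem_of_not_mem (ptr u).2 hJ) hD (F := F) fun u => hF _ (ptr u).2]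
  constructor
  · rintro ⟨ptr, ν, hpos, hrest⟩
    refine ⟨ν, fun a ha => ?_, hrest⟩
    obtain ⟨u, rfl⟩ := List.get_of_mem ha
    exact hpos u ▸ Finset.mem_image_of_mem F (ptr u).2
  · rintro ⟨ν, hpos, hrest⟩
    have exists_pointer (u : Fin p.pos.length) :
        ∃ i : J, F i = (p.pos.get u).map (Term.eval ν) := by
      simpa using hpos _ (p.pos.get_mem u)
    choose ptr hptr using exists_pointer
    exact ⟨ptr, ν, hptr, hrest⟩

end Correctness

end Queries

/-! ### Counting of critical tuples -/

section Tuples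

open Prog Function Finset

variable {K m : ℕ}

/-- Move the pointers `.inr 0, …, .inr (m - 1)` to the positions `y`. -/
def place (x : Bool ⊕ Fin K → ℕ) (y : Fin m → ℕ) : Bool ⊕ Fin K → ℕ
  | .inl b => x (.inl b)
  | .inr j => if h : j.1 < m then y ⟨j, h⟩ else x (.inr j)

/-- The scratch pointer `.inl false` and the pointers that `place` with `m` positions does not move
are at the beginning of the input. -/
def AtStart (m : ℕ) (x : Bool ⊕ Fin K → ℕ) : Prop :=
  x (.inl false) = 0 ∧ ∀ j : Fin K, m ≤ j → x (.inr j) = 0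

theorem AtStart.update {x : Bool ⊕ Fin K → ℕ} (hx : AtStart m x) (hm : m < K) (k : ℕ) :
    AtStart (m + 1) (update x (.inr ⟨m, hm⟩) k) := by
  refine ⟨by simpa using hx.1, fun j hj => ?_⟩
  have hne : j ≠ ⟨m, hm⟩ := fun h => by simp [h] at hj
  simpa [hne] using hx.2 j (by omega)

theorem place_succ (x : Bool ⊕ Fin K → ℕ) (hm : m < K) (y : Fin (m + 1) → ℕ) :
    place x y = update (place x fun j => y j.castSucc) (.inr ⟨m, hm⟩) (y (Fin.last m)) := by
  funext i
  rcases i with b | j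
  · simp [place]
  · obtain hj | rfl | hj := lt_trichotomy j ⟨m, hm⟩
    · have hlt : j.1 < m := hj
      simp [place, hj.ne, hlt, hlt.trans (Nat.lt_succ_self m)]
    · simp [place, Fin.last]
    · have hlt : m < j.1 := hj
      simp [place, hj.ne', hlt.not_gt, show ¬ j.1 < m + 1 by omega]

theorem Prog.PolyComputable.sum_place {N : List Sym → (Bool ⊕ Fin K → ℕ) → ℕ} (hm : m ≤ K)
    (h : PolyComputable (AtStart m) N) : PolyComputable (AtStart 0) fun s x =>
      ∑ y : Fin m → Fin s.length, N s (place x fun j => (y j : ℕ)) := by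
  induction m generalizing N with
  | zero =>
    refine h.congr fun s x _ => ?_
    have place_zero (y : Fin 0 → ℕ) : place x y = x := by
      funext i
      cases i <;> simp [place]
    simp [place_zero]
  | succ m ih =>
    refine (ih (Nat.le_of_succ_le hm) (h.sum_positions (fun x hx => hx.2 ⟨m, hm⟩ le_rfl)
      fun x k hx => hx.update hm k)).congr fun s x _ => ?_
    simp only [sum_range]
    rw [sum_comm, ← Fintype.sum_prod_type']
    refine Fintype.sum_equiv (Fin.snocEquiv fun _ => Fin s.length) _ _ fun z => ?_
    simp [place_succ x hm, Fin.snocEquiv]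

end Tuples

section CriticalTuples

open Prog Finset

variable {σ : Schema} {Const : Type} {Var : Type*} (relName : σ.Rel ↪ List Bool)
  (constName : Const ↪ List Bool) {ι κ : Type} [DecidableEq ι] [Fintype κ] [DecidableEq κ]

/-- The pointers `ptr` are at facts that form a critical tuple for the positive supports of `q`. -/
def CriticalAt (scratch : ι) (q : UCQNeg σ Const Var) (ptr : κ → ι) (s : List Sym)
    (x : ι → ℕ) : Prop :=
  (∀ j, IsStart s (x (ptr j))) ∧
    SupportedBy relName constName scratch q (univ.image ptr) s x ∧
    ∀ j, ¬ SupportedBy relName constName scratch q ((univ.erase j).image ptr) s x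

variable {relName constName} {scratch : ι} {q : UCQNeg σ Const Var} {ptr : κ → ι}

theorem polyDecidable_criticalAt {C : (ι → ℕ) → Prop} (hC : ∀ x, C x → x scratch = 0) :
    PolyDecidable C (CriticalAt relName constName scratch q ptr) :=
  (PolyDecidable.forall fun _ => polyDecidable_isStart _).and
    ((polyDecidable_supportedBy hC _ _).and
      (.forall fun _ => (polyDecidable_supportedBy hC _ _).not))

theorem criticalAt_iff [Nonempty κ] [DecidableEq (Fact σ Const)] {D : Finset (Fact σ Const)}
    {T : List (Fact σ Const)} (hD : ∀ f, f ∈ D ↔ f ∈ T) (hptr : ∀ j, ptr j ≠ scratch)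
    {x : ι → ℕ} {z : κ → Fact σ Const}
    (hz : ∀ j, FactAt relName constName T (x (ptr j)) (z j)) :
    CriticalAt relName constName scratch q ptr (encodeFacts relName constName T) x ↔
      Critical (IsPositiveSupport q D) z := by
  have : Nonempty (Fact σ Const) := .map z inferInstance
  have : Nonempty Const := .map (fun f : Fact σ Const => f.args ⟨0, σ.arity_pos _⟩) this
  obtain ⟨F, rfl⟩ : ∃ F : ι → Fact σ Const, z = F ∘ ptr :=
    (Function.factorsThrough_iff z).1 fun i j h => (h ▸ hz i).unique (hz j)
  have supported_iff (A : Finset κ) : SupportedBy relName constName scratch q (A.image ptr)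
      (encodeFacts relName constName T) x ↔ IsPositiveSupport q D (A.image (F ∘ ptr)) := by
    rw [← image_image]
    refine supportedBy_iff hD (by simp [hptr]) fun i hi => ?_
    obtain ⟨j, -, rfl⟩ := mem_image.1 hi
    exact hz j
  have all_start (j : κ) : IsStart (encodeFacts relName constName T) (x (ptr j)) :=
    (isStart_iff_exists_factAt.2 ⟨_, hz j⟩).2
  simp only [CriticalAt, Critical, supported_iff, all_start, implies_true, true_and]

end CriticalTuples

section Counting

open Prog Finset

variable {K m : ℕ} {σ : Schema} {Const : Type} {Var : Type*} (relName : σ.Rel ↪ List Bool)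
  (constName : Const ↪ List Bool) (q : UCQNeg σ Const Var)

/-- The pointers for the components of a tuple: `.inl true` stays at the distinguished fact, which
the input begins with, and `.inr j` runs through all positions. -/
def pointer (hm : m ≤ K) (j : Option (Fin m)) : Bool ⊕ Fin K :=
  j.elim (.inl true) fun j => .inr (j.castLE hm)

open scoped Classical in
/-- The numerator of the MPS-Shapley value over the denominator `K !`, for any bound `K` on the size
of the minimal positive supports. -/
noncomputable def numerator (K : ℕ) (s : List Sym) (x : Bool ⊕ Fin K → ℕ) : ℕ :=
  ∑ m : Fin K, ∑ y : Fin m → Fin s.length,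
    if CriticalAt relName constName (.inl false) q (pointer m.2.le) s (place x fun j => (y j : ℕ))
      then K.factorial / (m.1 + 1).factorial else 0

theorem polyComputable_numerator :
    PolyComputable (AtStart 0) (numerator relName constName q K) :=
  .sum univ fun m _ => .sum_place m.2.le (.ite (polyDecidable_criticalAt fun _ hx => hx.1)
    (.const _))

variable {relName constName q}

theorem place_pointer (hm : m ≤ K) (y : Fin m → ℕ) (j : Option (Fin m)) :
    place 0 y (pointer hm j) = j.elim 0 y := by
  cases j <;> simp [place, pointer]

section Correctness

variable [DecidableEq (Fact σ Const)] {D : Finset (Fact σ Const)} {T : List (Fact σ Const)}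
  {α : Fact σ Const}

theorem criticalAt_place_iff (hD : ∀ f, f ∈ D ↔ f ∈ α :: T) (hm : m ≤ K) {y : Fin m → ℕ}
    {z : Fin m → Fact σ Const} (hz : ∀ j, FactAt relName constName (α :: T) (y j) (z j)) :
    CriticalAt relName constName (.inl false) q (pointer hm)
        (encodeFacts relName constName (α :: T)) (place 0 y) ↔
      Critical (IsPositiveSupport q D) fun j : Option (Fin m) => j.elim α z := by
  refine criticalAt_iff hD (fun j => by cases j <;> simp [pointer]) fun j => ?_
  rw [place_pointer]
  cases j with
  | none => exact factAt_cons_iff.2 (.inl ⟨rfl, rfl⟩)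
  | some j => exact hz j

open scoped Classical in
theorem card_criticalAt (hD : ∀ f, f ∈ D ↔ f ∈ T) (hα : α ∈ D) (hT : T.Nodup) (hm : m ≤ K) :
    #{y : Fin m → Fin (encodeFacts relName constName (α :: T)).length |
      CriticalAt relName constName (.inl false) q (pointer hm)
        (encodeFacts relName constName (α :: T)) (place 0 fun j => (y j : ℕ))} =
      #{z : Fin m → D | Critical (IsPositiveSupport q D)
        fun j : Option (Fin m) => j.elim α fun j => (z j : Fact σ Const)} := by
  have hD' : ∀ f, f ∈ D ↔ f ∈ α :: T := fun f => by
    rw [List.mem_cons, ← hD]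
    exact ⟨.inr, fun h => h.elim (· ▸ hα) id⟩
  choose pos hpos using fun f : D =>
    exists_factAt (relName := relName) (constName := constName) ((hD f).1 f.2)
  have factAt_shift {p : ℕ} {f : Fact σ Const} (h : FactAt relName constName T p f) :
      FactAt relName constName (α :: T) ((encodeFact relName constName α).length + p) f :=
    factAt_cons_iff.2 (.inr ⟨p, rfl, h⟩)
  have shift_lt (f : D) := (isStart_iff_exists_factAt.2 ⟨_, factAt_shift (hpos f)⟩).1
  symm
  refine card_bij (fun z _ j => ⟨_, shift_lt (z j)⟩) (fun z hz => ?_) (fun z _ z' _ h => ?_)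
    fun y hy => ?_
  · rw [mem_filter_univ] at hz ⊢
    exact (criticalAt_place_iff hD' hm fun j => factAt_shift (hpos (z j))).2 hz
  · funext j
    have same_position : pos (z j) = pos (z' j) := by simpa using congrFun h j
    exact Subtype.ext ((hpos (z j)).unique (same_position ▸ hpos (z' j)))
  · rw [mem_filter_univ] at hy
    choose z hz using fun j => (isStart_iff_exists_factAt (relName := relName)
      (constName := constName) (T := α :: T)).1
      ⟨(y j).2, by simpa [place_pointer] using hy.1 (some j)⟩
    have critical := (criticalAt_place_iff hD' hm hz).1 hy
    refine ⟨fun j => ⟨z j, (hD' _).2 (hz j).mem⟩, (mem_filter_univ _).2 critical, ?_⟩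
    funext j
    -- `α :: T` contains `α` twice, but `α` is no further component of a critical tuple.
    obtain ⟨-, hαz⟩ | ⟨p, hp, hpz⟩ := factAt_cons_iff.1 (hz j)
    · exact absurd (critical.injective (a₁ := none) (a₂ := some j) hαz) (by simp)
    · exact Fin.ext (hp ▸ congrArg _ ((hpos ⟨z j, _⟩).position_unique hT hpz))

end Correctness

theorem mpsShapley_eq (I : Input σ Const) : mpsShapley q I.db I.fact =
    (numerator relName constName q q.width (encodeInput relName constName I) 0 : ℝ) /
      q.width.factorial := by
  classical
  have hD : ∀ f, f ∈ I.db ↔ f ∈ I.facts := fun f => by simp [Input.db]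
  have sum_minimal : mpsShapley q I.db I.fact = ∑ S ∈ I.db.powerset with
      Minimal (IsPositiveSupport q I.db) S ∧ I.target ∈ S, (1 : ℝ) / #S := by
    convert! shapley_card_subsets I.db (IsMinimalPositiveSupport q I.db) I.fact
  rw [sum_minimal, sum_one_div_card_minimal (α := I.target)
    (fun S T hST hT hS => hS.mono hST hT) I.fact.2 fun S => IsMinimalPositiveSupport.card_le,
    numerator, sum_range]
  congr 2
  refine sum_congr rfl fun m _ => ?_
  rw [← sum_filter, sum_const, smul_eq_mul, mul_comm]
  exact congrArg (· * _) (card_criticalAt hD I.fact.2 I.nodup m.2.le).symm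

end Counting

end DB

theorem mainTheorem2 (σ : DB.Schema) (Const : Type) (Var : Type*)
    (relName : σ.Rel ↪ List Bool) (constName : Const ↪ List Bool)
    (q : DB.UCQNeg σ Const Var) :
    ∃ f : DB.Input σ Const → ℚ,
      (∀ I : DB.Input σ Const, (f I : ℝ) = DB.mpsShapley q I.db I.fact) ∧
      Nonempty (Turing.TM2ComputableInPolyTime
        (DB.encodeInput relName constName) DB.encodeRat f) :=
  ⟨fun I => (DB.numerator relName constName q q.width (DB.encodeInput relName constName I) 0 : ℚ) /
      q.width.factorial,
    fun I => by
      rw [DB.mpsShapley_eq (relName := relName) (constName := constName)]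
      push_cast
      rfl,
    (DB.polyComputable_numerator relName constName q).computable_div ⟨rfl, fun _ _ => rfl⟩
      (.inl true) (Nat.factorial_pos _) _⟩
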